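/- Let $\mathcal F$ be a singular holomorphic foliation with isolated singularities on $\mathbb P^2$ (over $\mathbb C$), of degree $d$, and suppose that its automorphism group $\operatorname{Aut}(\mathcal F)\subset \operatorname{PGL}(3,\mathbb C)$ is finite. Suppose that, in suitable homogeneous coordinates $[X:Y:Z]$, $\operatorname{Aut}(\mathcal F)$ is generated by the transformation $[X:Y:Z]\mapsto[Y:Z:X]$, a transformation $[X:Y:Z]\mapsto[\mu Y:\nu X:Z]$ with $\mu,\nu\in\mathbb C^*$, and a group of transformations of the form $[X:Y:Z]\mapsto[aX:bY:Z]$ with $a,b\in\mathbb C^*$. Let $\mathcal F_d$ be the foliation defined by the homogeneous vector field $X^d\partial_X+Y^d\partial_Y+Z^d\partial_Z$, let $\mathcal G_d$ be the foliation defined in affine coordinates by the $1$-form $(y+y^d-2x^{d-1}y)\,dx+(x+x^d-2xy^{d-1})\,dy$, and let $\mathcal S$ be the foliation of degree $2$ defined by $YZ\,\partial_X+ZX\,\partial_Y+XY\,\partial_Z$. Two foliations are called isomorphic if some projective transformation maps one to the other. (1) Assume that the line at infinity $Z=0$ of these coordinates is invariant by $\mathcal F$. Then $|\operatorname{Aut}(\mathcal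 F)|\le 6(d-1)^2$, and equality holds if and only if $\mathcal F$ is isomorphic to $\mathcal F_d$ or to $\mathcal G_d$. Moreover, if $\mathcal F$ is isomorphic neither to $\mathcal F_d$ nor to $\mathcal G_d$, then $|\operatorname{Aut}(\mathcal F)|<3(d^2+d+1)$. (2) Assume that the line at infinity $Z=0$ of these coordinates is generically transverse to $\mathcal F$. Then $|\operatorname{Aut}(\mathcal F)|\ge 3(d^2+d+1)$ if and only if $\mathcal F$ is isomorphic to $\mathcal S$. -/

import Mathlib

open scoped MatrixGroups LinearAlgebra.Projectivization

noncomputable section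

namespace PlaneFoliation

/-- A polynomial vector field `v 0 ∂_X + v 1 ∂_Y + v 2 ∂_Z` on `ℂ³`. -/
abbrev VField : Type := Fin 3 → MvPolynomial (Fin 3) ℂ

/-- The value of the vector field `v` at the point `p` of `ℂ³`. -/
def VField.value (v : VField) (p : Fin 3 → ℂ) : Fin 3 → ℂ :=
  fun i => MvPolynomial.eval p (v i)

/-- The singular points of the distribution of lines induced on `ℙ²` by a homogeneous field `v`:
the points `[p]` at which `v` is tangent to the line `ℂ p`. (For `v` homogeneous the condition does
not depend on the representative of the point.) -/
def VField.singularSet (v : VField) : Set (ℙ ℂ (Fin 3 → ℂ)) :=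
  {p | ∃ c : ℂ, v.value p.rep = c • p.rep}

/-- The homogeneous fields `v` and `w` induce the same foliation: `w = α v + P R`, with
`α ∈ ℂ*`, `P` a polynomial and `R = X ∂_X + Y ∂_Y + Z ∂_Z` the radial field. If `v` and `w` are
homogeneous of degree `d`, then `P` is automatically zero or homogeneous of degree `d - 1`. -/
def SameFoliation (v w : VField) : Prop :=
  ∃ α : ℂ, α ≠ 0 ∧ ∃ P : MvPolynomial (Fin 3) ℂ,
    ∀ i, w i = MvPolynomial.C α * v i + P * MvPolynomial.X i

/-- The substitution `F ↦ F ∘ φ⁻¹` on polynomials. -/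
def compInv (φ : GL (Fin 3) ℂ) : MvPolynomial (Fin 3) ℂ →ₐ[ℂ] MvPolynomial (Fin 3) ℂ :=
  MvPolynomial.aeval fun k => ∑ l, MvPolynomial.C (φ⁻¹.val k l) * MvPolynomial.X l

/-- The pushforward `φ_* v = φ · (v ∘ φ⁻¹)` of a vector field by a linear automorphism of `ℂ³`. -/
def push (φ : GL (Fin 3) ℂ) (v : VField) : VField :=
  fun i => ∑ j, MvPolynomial.C (φ.val i j) * compInv φ (v j)

/-- A foliation of degree `d` with isolated singularities on `ℙ²`, presented by a homogeneous
vector field of degree `d` on `ℂ³`. Two presentations give the same foliation when they are related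
by `SameFoliation`; all the notions below only depend on the foliation. -/
structure Foliation (d : ℕ) where
  /-- a homogeneous vector field defining the foliation -/
  field : VField
  homogeneous : ∀ i, (field i).IsHomogeneous d
  isolated : field.singularSet.Finite

/-- The foliations induced by `v` and `w` are isomorphic (projectively equivalent). -/
def Isomorphic (v w : VField) : Prop :=
  ∃ φ : GL (Fin 3) ℂ, SameFoliation (push φ v) w

theorem compInv_X (φ : GL (Fin 3) ℂ) (k : Fin 3) :
    compInv φ (MvPolynomial.X k) =
      ∑ l, MvPolynomial.C (φ⁻¹.val k l) * MvPolynomial.X l := by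
  simp [compInv]

theorem compInv_C (φ : GL (Fin 3) ℂ) (a : ℂ) :
    compInv φ (MvPolynomial.C a) = MvPolynomial.C a := by
  simp [compInv]

theorem compInv_mul (φ ψ : GL (Fin 3) ℂ) (F : MvPolynomial (Fin 3) ℂ) :
    compInv (φ * ψ) F = compInv φ (compInv ψ F) := by
  have h : compInv (φ * ψ) = (compInv φ).comp (compInv ψ) := by
    apply MvPolynomial.algHom_ext
    intro k
    rw [AlgHom.comp_apply, compInv_X, compInv_X, map_sum, mul_inv_rev]
    simp only [map_mul, compInv_C, compInv_X, Units.val_mul, Matrix.mul_apply, map_sum,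
      Finset.sum_mul, Finset.mul_sum]
    rw [Finset.sum_comm]
    simp only [mul_assoc]
  rw [h, AlgHom.comp_apply]

theorem compInv_one (F : MvPolynomial (Fin 3) ℂ) : compInv 1 F = F := by
  have h : compInv 1 = AlgHom.id ℂ _ := by
    apply MvPolynomial.algHom_ext
    intro k
    rw [compInv_X]
    fin_cases k <;> simp [Matrix.one_apply]
  rw [h, AlgHom.id_apply]

theorem push_one (v : VField) : push 1 v = v := by
  funext i
  fin_cases i <;> simp [push, compInv_one, Matrix.one_apply]

theorem push_mul (φ ψ : GL (Fin 3) ℂ) (v : VField) : push (φ * ψ) v = push φ (push ψ v) := by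
  funext i
  simp only [push, compInv_mul, map_sum, map_mul, compInv_C, Units.val_mul, Matrix.mul_apply,
    Finset.sum_mul, Finset.mul_sum]
  rw [Finset.sum_comm]
  simp only [mul_assoc]

/-- The radial field is invariant, up to the change of coefficient. -/
theorem push_radial (φ : GL (Fin 3) ℂ) (P : MvPolynomial (Fin 3) ℂ) :
    push φ (fun i => P * MvPolynomial.X i) = fun i => compInv φ P * MvPolynomial.X i := by
  funext i
  have h : ∀ l, ∑ j, φ.val i j * φ⁻¹.val j l = (1 : Matrix (Fin 3) (Fin 3) ℂ) i l := by
    intro l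
    rw [← Matrix.mul_apply, ← Units.val_mul, mul_inv_cancel, Units.val_one]
  have h2 : ∑ j, MvPolynomial.C (φ.val i j) *
      ∑ l, MvPolynomial.C (φ⁻¹.val j l) * MvPolynomial.X l
        = (MvPolynomial.X i : MvPolynomial (Fin 3) ℂ) := by
    calc _ = ∑ l, MvPolynomial.C (∑ j, φ.val i j * φ⁻¹.val j l) * MvPolynomial.X l := by
          simp only [Finset.mul_sum, map_sum, map_mul, Finset.sum_mul]
          rw [Finset.sum_comm]
          simp only [mul_assoc]
      _ = _ := by
          simp only [h]
          fin_cases i <;> simp [Matrix.one_apply]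
  simp only [push, map_mul, compInv_X]
  conv_rhs => rw [← h2]
  rw [Finset.mul_sum]
  exact Finset.sum_congr rfl fun j _ => by ring

theorem SameFoliation.refl (v : VField) : SameFoliation v v :=
  ⟨1, one_ne_zero, 0, fun i => by simp⟩

theorem SameFoliation.symm {v w : VField} (h : SameFoliation v w) : SameFoliation w v := by
  obtain ⟨α, hα, P, hP⟩ := h
  refine ⟨α⁻¹, inv_ne_zero hα, -(MvPolynomial.C α⁻¹ * P), fun i => ?_⟩
  have : MvPolynomial.C α⁻¹ * MvPolynomial.C α = (1 : MvPolynomial (Fin 3) ℂ) := by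
    rw [← map_mul, inv_mul_cancel₀ hα, map_one]
  rw [hP i]
  linear_combination (-(v i)) * this

theorem SameFoliation.trans {u v w : VField} (h : SameFoliation u v) (h' : SameFoliation v w) :
    SameFoliation u w := by
  obtain ⟨α, hα, P, hP⟩ := h
  obtain ⟨β, hβ, Q, hQ⟩ := h'
  refine ⟨β * α, mul_ne_zero hβ hα, MvPolynomial.C β * P + Q, fun i => ?_⟩
  rw [hQ i, hP i, map_mul]
  ring

theorem SameFoliation.push {v w : VField} (h : SameFoliation v w) (φ : GL (Fin 3) ℂ) :
    SameFoliation (push φ v) (push φ w) := by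
  obtain ⟨α, hα, P, hP⟩ := h
  refine ⟨α, hα, compInv φ P, fun i => ?_⟩
  have hr := congrFun (push_radial φ P) i
  simp only [PlaneFoliation.push] at hr ⊢
  rw [← hr, Finset.mul_sum, ← Finset.sum_add_distrib]
  refine Finset.sum_congr rfl fun j _ => ?_
  rw [hP j, map_add, map_mul, compInv_C]
  ring

/-- The linear automorphisms of `ℂ³` whose projectivization preserves the foliation induced by
`v`, that is, those `φ` such that `φ_* v` also defines this foliation. -/
def linearAut (v : VField) : Subgroup (GL (Fin 3) ℂ) where
  carrier := {φ | SameFoliation v (push φ v)}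
  one_mem' := by
    rw [Set.mem_ofPred_eq, push_one]
    exact SameFoliation.refl v
  mul_mem' := by
    intro φ ψ hφ hψ
    rw [Set.mem_ofPred_eq, push_mul]
    exact SameFoliation.trans hφ (SameFoliation.push hψ φ)
  inv_mem' := by
    intro φ hφ
    have h := SameFoliation.push hφ φ⁻¹
    rw [← push_mul, inv_mul_cancel, push_one] at h
    exact h.symm

/-- The automorphism group `Aut(F)`, a group of projective transformations of `ℙ²`. -/
def Foliation.Aut {d : ℕ} (F : Foliation d) : Subgroup PGL(3, ℂ) :=
  (linearAut F.field).map Matrix.ProjGenLinGroup.mk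

/-- The line `{ℓ 0 X + ℓ 1 Y + ℓ 2 Z = 0}` of `ℙ²` is invariant by the foliation induced by `v`:
at each point of the line, the direction of `v` is tangent to the line. -/
def LineInvariant (v : VField) (ℓ : Fin 3 → ℂ) : Prop :=
  ∀ p : Fin 3 → ℂ, ℓ ⬝ᵥ p = 0 → ℓ ⬝ᵥ v.value p = 0

/-- The line `{ℓ 0 X + ℓ 1 Y + ℓ 2 Z = 0}` is generically transverse to the foliation induced by
`v`: the foliation is transverse to the line at some (hence at all but finitely many) of its
points. -/
def LineGenericallyTransverse (v : VField) (ℓ : Fin 3 → ℂ) : Prop :=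
  ∃ p : Fin 3 → ℂ, ℓ ⬝ᵥ p = 0 ∧ ℓ ⬝ᵥ v.value p ≠ 0

/-- `(X, Y, Z) ↦ (Y, Z, X)`. -/
def cyclicMap : GL (Fin 3) ℂ where
  val := !![0, 1, 0; 0, 0, 1; 1, 0, 0]
  inv := !![0, 0, 1; 1, 0, 0; 0, 1, 0]
  val_inv := by ext i j; fin_cases i <;> fin_cases j <;> simp [Matrix.mul_apply, Fin.sum_univ_three]
  inv_val := by ext i j; fin_cases i <;> fin_cases j <;> simp [Matrix.mul_apply, Fin.sum_univ_three]

/-- `(X, Y, Z) ↦ (μ Y, ν X, Z)`. -/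
def swapMap (μ ν : ℂˣ) : GL (Fin 3) ℂ where
  val := !![0, (μ : ℂ), 0; (ν : ℂ), 0, 0; 0, 0, 1]
  inv := !![0, ((ν⁻¹ : ℂˣ) : ℂ), 0; ((μ⁻¹ : ℂˣ) : ℂ), 0, 0; 0, 0, 1]
  val_inv := by ext i j; fin_cases i <;> fin_cases j <;> simp [Matrix.mul_apply, Fin.sum_univ_three]
  inv_val := by ext i j; fin_cases i <;> fin_cases j <;> simp [Matrix.mul_apply, Fin.sum_univ_three]

/-- `(X, Y, Z) ↦ (a X, b Y, Z)`. -/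
def diagonalMap (a b : ℂˣ) : GL (Fin 3) ℂ where
  val := !![(a : ℂ), 0, 0; 0, (b : ℂ), 0; 0, 0, 1]
  inv := !![((a⁻¹ : ℂˣ) : ℂ), 0, 0; 0, ((b⁻¹ : ℂˣ) : ℂ), 0; 0, 0, 1]
  val_inv := by ext i j; fin_cases i <;> fin_cases j <;> simp [Matrix.mul_apply, Fin.sum_univ_three]
  inv_val := by ext i j; fin_cases i <;> fin_cases j <;> simp [Matrix.mul_apply, Fin.sum_univ_three]

/-- A group of projective transformations generated by `[X:Y:Z] ↦ [Y:Z:X]`, a transformation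
`[X:Y:Z] ↦ [μ Y:ν X:Z]`, and a group of transformations `[X:Y:Z] ↦ [a X:b Y:Z]`. -/
def IsSecondType (G : Subgroup PGL(3, ℂ)) : Prop :=
  ∃ (μ ν : ℂˣ) (H : Subgroup PGL(3, ℂ)),
    (∀ h ∈ H, ∃ a b : ℂˣ, h = Matrix.ProjGenLinGroup.mk (diagonalMap a b)) ∧
    G = Subgroup.closure
      ({Matrix.ProjGenLinGroup.mk cyclicMap, Matrix.ProjGenLinGroup.mk (swapMap μ ν)} ∪
        (H : Set PGL(3, ℂ)))

/-- `G` is of the second type when written in the homogeneous coordinates `X' = ψ X`: in these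
coordinates a transformation `g` reads `ψ g ψ⁻¹`. -/
def IsSecondTypeIn (ψ : GL (Fin 3) ℂ) (G : Subgroup PGL(3, ℂ)) : Prop :=
  IsSecondType (G.map (MulAut.conj (Matrix.ProjGenLinGroup.mk ψ)).toMonoidHom)

/-- The linear form `ℓ` (the third coordinate function) such that `{ℓ = 0}` is the line at infinity
`Z' = 0` of the homogeneous coordinates `X' = ψ X`. -/
def infinityForm (ψ : GL (Fin 3) ℂ) : Fin 3 → ℂ := fun j => ψ.val 2 j

open MvPolynomial in
/-- The Fermat foliation `F_d`: `X^d ∂_X + Y^d ∂_Y + Z^d ∂_Z`. -/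
def fermatField (d : ℕ) : VField := ![X 0 ^ d, X 1 ^ d, X 2 ^ d]

open MvPolynomial in
/-- The foliation `G_d`, defined in the affine coordinates `x = X/Z`, `y = Y/Z` by the 1-form
`A dx + B dy` with `A = y + y^d - 2 x^(d-1) y` and `B = x + x^d - 2 x y^(d-1)`: the homogenization
of the affine field `-B ∂_x + A ∂_y` of degree `d`. -/
def gField (d : ℕ) : VField :=
  ![-(X 0 * (X 2 ^ (d - 1) + X 0 ^ (d - 1) - 2 * X 1 ^ (d - 1))),
    X 1 * (X 2 ^ (d - 1) + X 1 ^ (d - 1) - 2 * X 0 ^ (d - 1)),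
    0]

open MvPolynomial in
/-- The foliation `S` of degree `2`: `YZ ∂_X + ZX ∂_Y + XY ∂_Z`. -/
def sField : VField := ![X 1 * X 2, X 2 * X 0, X 0 * X 1]

end PlaneFoliation

end

/-! Let w be the field in the coordinates X' = ψ X. Its automorphisms are classes of monomial
matrices inducing every permutation of the axes, so |Aut| ≤ 6 |D| with D the group of diagonal
automorphisms (`card_projAut_le`). Comparing coefficients, modulo the radial field, for one monomial
X^a Y^b and its permuted copies traps D in pairs of g-th roots of unity. By Lagrange, D is the whole
of μ_g × μ_g or at most half of it.

Invariant line: by symmetry all three axes are invariant, so w i = X i * Q i and only differences of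
the Q i matter. Isolated singularities supply X^a Y^b in such a difference, with a + b = d - 1, and
g = gcd(a, b). If a, b > 0, then g ≤ (d - 1)/2. Otherwise g = d - 1: either D is at most half of μ_g
× μ_g, so that |Aut| ≤ 3(d - 1)², or D is everything, only pure powers survive, and the
transposition of two axes leaves just the two models (`isomorphic_of_pure`). Conversely, the models
carry 6(d - 1)² explicit automorphisms.

Transverse line: X^a Y^b occurs in the third component, with a + b = d, and g = gcd(a + 1, b + 1) ≤
(d + 2)/2. Then 6g² ≥ 3(d² + d + 1) forces d ≤ 2. Degree 0 has a non-monomial automorphism and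
degree 1 has too few, so d = 2, a = b = 1 and D consists of all sign changes, which determines the
foliation (`isomorphic_sField`). -/

noncomputable section

namespace PlaneFoliation

open MvPolynomial Matrix

/-! ### Monomial matrices and their projective classes. -/

/-- The monomial matrix sending the basis vector `e j` to `s j • e (σ j)`. -/
def monomialGL (σ : Equiv.Perm (Fin 3)) (s : Fin 3 → ℂˣ) : GL (Fin 3) ℂ where
  val := Matrix.of fun i j => if i = σ j then (s j : ℂ) else 0
  inv := Matrix.of fun i j => if σ i = j then ((s i)⁻¹ : ℂˣ) else (0 : ℂ)
  val_inv := by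
    ext i j
    rw [Matrix.mul_apply, ← Equiv.sum_comp σ.symm]
    simp [Matrix.one_apply]
  inv_val := by
    ext i j
    simp only [Matrix.mul_apply, Matrix.of_apply]
    rw [Finset.sum_eq_single (σ i)]
    · rw [Matrix.one_apply]
      simp only [σ.injective.eq_iff, if_true]
      split_ifs with h <;> simp [h]
    · intro b _ hb
      simp [Ne.symm hb]
    · simp

theorem monomialGL_apply (σ : Equiv.Perm (Fin 3)) (s : Fin 3 → ℂˣ) (i j : Fin 3) :
    (monomialGL σ s).val i j = if i = σ j then (s j : ℂ) else 0 := rfl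

theorem monomialGL_inv_apply (σ : Equiv.Perm (Fin 3)) (s : Fin 3 → ℂˣ) (i j : Fin 3) :
    (monomialGL σ s)⁻¹.val i j = if σ i = j then (((s i)⁻¹ : ℂˣ) : ℂ) else 0 := rfl

theorem monomialGL_mul (σ τ : Equiv.Perm (Fin 3)) (s t : Fin 3 → ℂˣ) :
    monomialGL σ s * monomialGL τ t = monomialGL (σ * τ) (fun j => s (τ j) * t j) := by
  ext i j
  simp [Matrix.mul_apply, monomialGL_apply]
  rfl

theorem monomialGL_one : monomialGL 1 1 = 1 := by
  ext i j
  simp [monomialGL_apply, Matrix.one_apply]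
  rfl

theorem monomialGL_inv (σ : Equiv.Perm (Fin 3)) (s : Fin 3 → ℂˣ) :
    (monomialGL σ s)⁻¹ = monomialGL σ⁻¹ (fun j => (s (σ⁻¹ j))⁻¹) := by
  rw [inv_eq_iff_mul_eq_one, monomialGL_mul, ← monomialGL_one, mul_inv_cancel]
  congr 1
  ext j
  simp

theorem monomialGL_injective {σ τ : Equiv.Perm (Fin 3)} {s t : Fin 3 → ℂˣ}
    (h : monomialGL σ s = monomialGL τ t) : σ = τ ∧ s = t := by
  have h1 : ∀ j, σ j = τ j ∧ s j = t j := by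
    intro j
    have := congrArg (fun g : GL (Fin 3) ℂ => g.val (σ j) j) h
    simp only [monomialGL_apply, if_true] at this
    split_ifs at this with hc
    · exact ⟨hc, Units.ext this⟩
    · exact absurd this (s j).ne_zero
  exact ⟨Equiv.ext fun j => (h1 j).1, funext fun j => (h1 j).2⟩

theorem scalar_eq_monomialGL (u : ℂˣ) :
    GeneralLinearGroup.scalar (Fin 3) u = monomialGL 1 (fun _ => u) := by
  ext i j
  rw [monomialGL_apply]
  change Matrix.diagonal (fun _ => (u : ℂ)) i j = _
  rw [Matrix.diagonal_apply]
  rfl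

theorem cyclicMap_eq : cyclicMap = monomialGL (Equiv.addRight 2) 1 := by
  ext i j
  fin_cases i <;> fin_cases j <;> simp [cyclicMap, monomialGL_apply]

theorem swapMap_eq (μ ν : ℂˣ) : swapMap μ ν = monomialGL (Equiv.swap 0 1) ![ν, μ, 1] := by
  ext i j
  fin_cases i <;> fin_cases j <;> simp [swapMap, monomialGL_apply] <;> decide

theorem diagonalMap_eq (a b : ℂˣ) : diagonalMap a b = monomialGL 1 ![a, b, 1] := by
  ext i j
  fin_cases i <;> fin_cases j <;> simp [diagonalMap, monomialGL_apply]

/-- The diagonal matrices `diag(a, b, 1)`. -/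
def diagHom : ℂˣ × ℂˣ →* GL (Fin 3) ℂ where
  toFun p := monomialGL 1 ![p.1, p.2, 1]
  map_one' := by
    rw [← monomialGL_one]
    congr 1
    ext j
    fin_cases j <;> simp
  map_mul' p q := by
    rw [monomialGL_mul]
    congr 1
    ext j
    fin_cases j <;> simp

theorem diagHom_apply (p : ℂˣ × ℂˣ) : diagHom p = monomialGL 1 ![p.1, p.2, 1] := rfl

theorem monomialGL_mul_scalar (σ : Equiv.Perm (Fin 3)) (s : Fin 3 → ℂˣ) (u : ℂˣ) :
    monomialGL σ s * GeneralLinearGroup.scalar (Fin 3) u = monomialGL σ (fun j => s j * u) := by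
  rw [scalar_eq_monomialGL, monomialGL_mul, mul_one]
  rfl

/-- Monomial matrices normalized by `s 2 = 1` are determined by their projective class. -/
theorem mk_monomialGL_injective {σ τ : Equiv.Perm (Fin 3)} {s t : Fin 3 → ℂˣ}
    (hs : s 2 = 1) (ht : t 2 = 1)
    (h : ProjGenLinGroup.mk (monomialGL σ s) = ProjGenLinGroup.mk (monomialGL τ t)) :
    σ = τ ∧ s = t := by
  obtain ⟨u, hu⟩ := ProjGenLinGroup.mk_eq_mk_iff.1 h
  rw [monomialGL_mul_scalar] at hu
  obtain ⟨h1, h2⟩ := monomialGL_injective hu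
  have h3 := congrFun h2 2
  simp only [hs, ht, one_mul] at h3
  subst h3
  exact ⟨h1, by simpa using h2⟩

/-- The projective classes of monomial matrices. -/
def monomialSubgroup : Subgroup PGL(3, ℂ) where
  carrier := {g | ∃ σ s, g = ProjGenLinGroup.mk (monomialGL σ s)}
  one_mem' := ⟨1, 1, by rw [monomialGL_one, map_one]⟩
  mul_mem' := by
    rintro _ _ ⟨σ, s, rfl⟩ ⟨τ, t, rfl⟩
    exact ⟨_, _, by rw [← map_mul, monomialGL_mul]⟩
  inv_mem' := by
    rintro _ ⟨σ, s, rfl⟩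
    exact ⟨_, _, by rw [← map_inv, monomialGL_inv]⟩

theorem IsSecondType.le_monomialSubgroup {G : Subgroup PGL(3, ℂ)} (h : IsSecondType G) :
    G ≤ monomialSubgroup := by
  obtain ⟨μ, ν, H, hH, rfl⟩ := h
  rw [Subgroup.closure_le]
  rintro g ((rfl | rfl) | hg)
  · exact ⟨_, _, by rw [cyclicMap_eq]⟩
  · exact ⟨_, _, by rw [swapMap_eq]⟩
  · obtain ⟨a, b, rfl⟩ := hH g hg
    exact ⟨_, _, by rw [diagonalMap_eq]⟩

theorem IsSecondType.mk_cyclicMap_mem {G : Subgroup PGL(3, ℂ)} (h : IsSecondType G) :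
    ProjGenLinGroup.mk cyclicMap ∈ G := by
  obtain ⟨μ, ν, H, hH, rfl⟩ := h
  exact Subgroup.subset_closure (by simp)

theorem IsSecondType.mk_swapMap_mem {G : Subgroup PGL(3, ℂ)} (h : IsSecondType G) :
    ∃ μ ν, ProjGenLinGroup.mk (swapMap μ ν) ∈ G := by
  obtain ⟨μ, ν, H, hH, rfl⟩ := h
  exact ⟨μ, ν, Subgroup.subset_closure (by simp)⟩

/-! ### Automorphism groups under change of coordinates. -/

/-- The projective automorphism group of the foliation induced by a field. -/
def projAut (v : VField) : Subgroup PGL(3, ℂ) := (linearAut v).map ProjGenLinGroup.mk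

theorem mem_linearAut {v : VField} {φ : GL (Fin 3) ℂ} :
    φ ∈ linearAut v ↔ SameFoliation v (push φ v) := Iff.rfl

theorem linearAut_push (ψ : GL (Fin 3) ℂ) (v : VField) :
    linearAut (push ψ v) = (linearAut v).map (MulAut.conj ψ).toMonoidHom := by
  ext φ
  rw [Subgroup.mem_map_equiv, mem_linearAut, mem_linearAut, ← push_mul]
  constructor
  · intro h
    have := h.push ψ⁻¹
    rw [← push_mul, ← push_mul, inv_mul_cancel, push_one] at this
    simpa [mul_assoc] using this
  · intro h
    have := h.push ψ
    rw [← push_mul] at this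
    simpa [mul_assoc] using this

theorem projAut_push (ψ : GL (Fin 3) ℂ) (v : VField) :
    projAut (push ψ v) =
      (projAut v).map (MulAut.conj (ProjGenLinGroup.mk ψ)).toMonoidHom := by
  rw [projAut, projAut, linearAut_push, Subgroup.map_map, Subgroup.map_map]
  congr 1

theorem linearAut_eq_of_sameFoliation {v w : VField} (h : SameFoliation v w) :
    linearAut v = linearAut w := by
  ext φ
  exact ⟨fun h' => h.symm.trans (h'.trans (h.push φ)),
    fun h' => h.trans (h'.trans (h.symm.push φ))⟩

theorem card_projAut_push (ψ : GL (Fin 3) ℂ) (v : VField) :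
    Nat.card (projAut (push ψ v)) = Nat.card (projAut v) := by
  rw [projAut_push]
  exact (Nat.card_congr ((projAut v).equivMapOfInjective _
    (MulAut.conj (ProjGenLinGroup.mk ψ)).injective).toEquiv).symm

theorem card_projAut_of_isomorphic {v w : VField} (h : Isomorphic v w) :
    Nat.card (projAut w) = Nat.card (projAut v) := by
  obtain ⟨φ, hφ⟩ := h
  rw [projAut, ← linearAut_eq_of_sameFoliation hφ]
  exact card_projAut_push φ v

theorem isomorphic_push_iff (ψ : GL (Fin 3) ℂ) (v w : VField) :
    Isomorphic (push ψ v) w ↔ Isomorphic v w := by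
  constructor
  · rintro ⟨φ, h⟩
    exact ⟨φ * ψ, by rwa [push_mul]⟩
  · rintro ⟨φ, h⟩
    exact ⟨φ * ψ⁻¹, by rwa [← push_mul, inv_mul_cancel_right]⟩

theorem isomorphic_of_sameFoliation_right {u v w : VField} (h : Isomorphic u v)
    (h' : SameFoliation v w) : Isomorphic u w := by
  obtain ⟨φ, h⟩ := h
  exact ⟨φ, h.trans h'⟩

/-! ### Action of monomial matrices on coefficients. -/

/-- The value of the monomial with exponent `m` at `s`. -/
def monomialValue (s : Fin 3 → ℂˣ) (m : Fin 3 →₀ ℕ) : ℂˣ := ∏ k, s k ^ m k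

theorem monomialValue_add (s : Fin 3 → ℂˣ) (m m' : Fin 3 →₀ ℕ) :
    monomialValue s (m + m') = monomialValue s m * monomialValue s m' := by
  simp [monomialValue, pow_add, Finset.prod_mul_distrib]

theorem monomialValue_single (s : Fin 3 → ℂˣ) (k : Fin 3) (n : ℕ) :
    monomialValue s (Finsupp.single k n) = s k ^ n := by
  rw [monomialValue, Finset.prod_eq_single k]
  · simp
  · intro b _ hb
    simp [Finsupp.single_eq_of_ne hb]
  · simp

theorem monomialValue_mapDomain (s : Fin 3 → ℂˣ) (σ : Equiv.Perm (Fin 3)) (m : Fin 3 →₀ ℕ) :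
    monomialValue s (m.mapDomain σ) = ∏ k, s (σ k) ^ m k := by
  rw [monomialValue, ← Equiv.prod_comp σ]
  simp [Finsupp.mapDomain_apply σ.injective]

theorem coeff_aeval_C_mul_X (c : Fin 3 → ℂ) (f : MvPolynomial (Fin 3) ℂ) (m : Fin 3 →₀ ℕ) :
    coeff m (aeval (fun k => C (c k) * X k : Fin 3 → MvPolynomial (Fin 3) ℂ) f) =
      (∏ k, c k ^ m k) * coeff m f := by
  induction f using MvPolynomial.induction_on' with
  | monomial u a =>
    have h : aeval (fun k => C (c k) * X k : Fin 3 → MvPolynomial (Fin 3) ℂ) (monomial u a) =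
        monomial u ((∏ k, c k ^ u k) * a) := by
      rw [aeval_monomial, Finsupp.prod_fintype _ _ (by simp), mul_comm _ a,
        ← C_mul_monomial]
      simp only [mul_pow, Finset.prod_mul_distrib, algebraMap_eq]
      rw [monomial_eq, Finsupp.prod_fintype _ _ (by simp)]
      simp
    rw [h, coeff_monomial, coeff_monomial]
    split_ifs with hu
    · rw [hu]
    · simp
  | add p q hp hq => rw [map_add, coeff_add, coeff_add, hp, hq, mul_add]

theorem compInv_monomialGL_X (σ : Equiv.Perm (Fin 3)) (s : Fin 3 → ℂˣ) (k : Fin 3) :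
    compInv (monomialGL σ s) (X k) = C (((s k)⁻¹ : ℂˣ) : ℂ) * X (σ k) := by
  rw [compInv_X, Finset.sum_eq_single (σ k)]
  · simp [monomialGL_inv_apply]
  · intro b _ hb
    simp [monomialGL_inv_apply, Ne.symm hb]
  · simp

theorem coeff_compInv_monomialGL (σ : Equiv.Perm (Fin 3)) (s : Fin 3 → ℂˣ)
    (f : MvPolynomial (Fin 3) ℂ) (m : Fin 3 →₀ ℕ) :
    coeff (m.mapDomain σ) (compInv (monomialGL σ s) f) =
      ((monomialValue s m)⁻¹ : ℂˣ) * coeff m f := by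
  have h : compInv (monomialGL σ s) =
      (rename σ).comp (aeval fun k => C (((s k)⁻¹ : ℂˣ) : ℂ) * X k) := by
    apply MvPolynomial.algHom_ext
    intro k
    simp only [compInv_monomialGL_X, AlgHom.comp_apply, aeval_X, map_mul, rename_C, rename_X]
  rw [h, AlgHom.comp_apply, coeff_rename_mapDomain _ σ.injective, coeff_aeval_C_mul_X]
  simp [monomialValue]

theorem push_monomialGL (σ : Equiv.Perm (Fin 3)) (s : Fin 3 → ℂˣ) (w : VField) (j : Fin 3) :
    push (monomialGL σ s) w (σ j) = C (s j : ℂ) * compInv (monomialGL σ s) (w j) := by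
  rw [push, Finset.sum_eq_single j]
  · simp [monomialGL_apply]
  · intro b _ hb
    simp [monomialGL_apply, Ne.symm hb]
  · simp

theorem coeff_push_monomialGL (σ : Equiv.Perm (Fin 3)) (s : Fin 3 → ℂˣ) (w : VField) (j : Fin 3)
    (m : Fin 3 →₀ ℕ) :
    coeff (m.mapDomain σ) (push (monomialGL σ s) w (σ j)) =
      s j * ((monomialValue s m)⁻¹ : ℂˣ) * coeff m (w j) := by
  rw [push_monomialGL, coeff_C_mul, coeff_compInv_monomialGL, mul_assoc]

/-- The comparison of coefficients for a monomial automorphism of a foliation. -/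
theorem exists_coeff_relation {w : VField} {σ : Equiv.Perm (Fin 3)} {s : Fin 3 → ℂˣ}
    (h : monomialGL σ s ∈ linearAut w) :
    ∃ α : ℂ, α ≠ 0 ∧ ∃ P : MvPolynomial (Fin 3) ℂ, ∀ j m,
      s j * ((monomialValue s m)⁻¹ : ℂˣ) * coeff m (w j) =
        α * coeff (m.mapDomain σ) (w (σ j)) + coeff (m.mapDomain σ) (P * X (σ j)) := by
  obtain ⟨α, hα, P, hP⟩ := h
  refine ⟨α, hα, P, fun j m => ?_⟩
  rw [← coeff_push_monomialGL, hP, coeff_add, coeff_C_mul]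

theorem degree_eq_of_coeff_ne_zero {d : ℕ} {f : MvPolynomial (Fin 3) ℂ} (hf : f.IsHomogeneous d)
    {m : Fin 3 →₀ ℕ} (hm : coeff m f ≠ 0) : m 0 + m 1 + m 2 = d := by
  by_contra h
  refine hm (hf.coeff_eq_zero ?_)
  rwa [Finsupp.degree_eq_sum, Fin.sum_univ_three]

/-- By homogeneity the scalar u multiplies the field by u^(1-d). Hence membership in the projective
group can be tested on any representative. -/
theorem scalar_mem_linearAut {d : ℕ} {w : VField} (hw : ∀ i, (w i).IsHomogeneous d) (u : ℂˣ) :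
    GeneralLinearGroup.scalar (Fin 3) u ∈ linearAut w := by
  rw [scalar_eq_monomialGL, mem_linearAut]
  refine ⟨u * ((u ^ d)⁻¹ : ℂˣ), by simp, 0, fun i => ?_⟩
  ext m
  have h := coeff_push_monomialGL 1 (fun _ => u) w i m
  rw [Equiv.Perm.coe_one, Finsupp.mapDomain_id] at h
  rw [zero_mul, add_zero, coeff_C_mul]
  refine h.trans ?_
  by_cases hm : coeff m (w i) = 0
  · simp [hm]
  · rw [← degree_eq_of_coeff_ne_zero (hw i) hm, monomialValue, Fin.prod_univ_three, ← pow_add,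
      ← pow_add]

theorem mk_mem_projAut_iff {d : ℕ} {w : VField} (hw : ∀ i, (w i).IsHomogeneous d)
    {φ : GL (Fin 3) ℂ} : ProjGenLinGroup.mk φ ∈ projAut w ↔ φ ∈ linearAut w := by
  refine ⟨?_, fun h => ⟨φ, h, rfl⟩⟩
  rintro ⟨φ', h, he⟩
  obtain ⟨u, rfl⟩ := ProjGenLinGroup.mk_eq_mk_iff.1 he
  exact mul_mem h (scalar_mem_linearAut hw u)

/-! ### Diagonal automorphisms and permutations of the axes. -/

/-- The diagonal automorphisms `diag(a, b, 1)`. -/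
def diagonalAut (w : VField) : Subgroup (ℂˣ × ℂˣ) := (linearAut w).comap diagHom

theorem mem_diagonalAut {w : VField} {p : ℂˣ × ℂˣ} :
    p ∈ diagonalAut w ↔ monomialGL 1 ![p.1, p.2, 1] ∈ linearAut w := Iff.rfl

theorem diagHom_mk_injective :
    Function.Injective fun p => (ProjGenLinGroup.mk (diagHom p) : PGL(3, ℂ)) := by
  intro p q h
  have := (mk_monomialGL_injective (by simp) (by simp) h).2
  exact Prod.ext (by simpa using congrFun this 0) (by simpa using congrFun this 1)

theorem finite_diagonalAut {w : VField} (h : Finite (projAut w)) : Finite (diagonalAut w) :=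
  Finite.of_injective
    (fun p : diagonalAut w => (⟨ProjGenLinGroup.mk (diagHom p), diagHom p, p.2, rfl⟩ : projAut w))
    fun _ _ hpq => Subtype.ext (diagHom_mk_injective (congrArg Subtype.val hpq))

/-- Two automorphisms with the same permutation differ by a diagonal one up to a scalar, so there
are at most six cosets. -/
theorem card_projAut_le {d : ℕ} {w : VField} (hw : ∀ i, (w i).IsHomogeneous d)
    (hfin : Finite (projAut w)) (hmon : projAut w ≤ monomialSubgroup) :
    Nat.card (projAut w) ≤ 6 * Nat.card (diagonalAut w) := by
  classical
  have := finite_diagonalAut hfin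
  -- One automorphism is chosen over each permutation; 1 is a dummy value over permutations that are
  -- not realized.
  have hg : ∀ σ : Equiv.Perm (Fin 3), ∃ g ∈ linearAut w,
      (∃ s, monomialGL σ s ∈ linearAut w) → ∃ s, g = monomialGL σ s := by
    intro σ
    by_cases h : ∃ s, monomialGL σ s ∈ linearAut w
    · obtain ⟨s, hs⟩ := h
      exact ⟨_, hs, fun _ => ⟨s, rfl⟩⟩
    · exact ⟨1, one_mem _, fun h' => absurd h' h⟩
  choose g hg hg' using hg
  let f : Equiv.Perm (Fin 3) × diagonalAut w → projAut w := fun x =>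
    ⟨ProjGenLinGroup.mk (g x.1 * diagHom x.2), _, mul_mem (hg _) x.2.2, rfl⟩
  have hf : Function.Surjective f := by
    rintro ⟨a, ha⟩
    obtain ⟨σ, s, rfl⟩ := hmon ha
    rw [mk_mem_projAut_iff hw] at ha
    obtain ⟨t, ht⟩ := hg' σ ⟨s, ha⟩
    -- Dividing by the scalar t₂⁻¹ s₂ makes the last diagonal entry equal to 1.
    have key : monomialGL σ s = g σ * diagHom ((t 0)⁻¹ * s 0 * ((t 2)⁻¹ * s 2)⁻¹,
        (t 1)⁻¹ * s 1 * ((t 2)⁻¹ * s 2)⁻¹) *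
        GeneralLinearGroup.scalar (Fin 3) ((t 2)⁻¹ * s 2) := by
      rw [ht, diagHom_apply, monomialGL_mul, monomialGL_mul_scalar, mul_one]
      congr 1
      ext j
      fin_cases j <;> simp [mul_assoc]
    have hmem : ((t 0)⁻¹ * s 0 * ((t 2)⁻¹ * s 2)⁻¹,
        (t 1)⁻¹ * s 1 * ((t 2)⁻¹ * s 2)⁻¹) ∈ diagonalAut w := by
      rw [diagonalAut, Subgroup.mem_comap]
      have h1 : diagHom ((t 0)⁻¹ * s 0 * ((t 2)⁻¹ * s 2)⁻¹,
          (t 1)⁻¹ * s 1 * ((t 2)⁻¹ * s 2)⁻¹) = (g σ)⁻¹ * monomialGL σ s *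
            (GeneralLinearGroup.scalar (Fin 3) ((t 2)⁻¹ * s 2))⁻¹ := by
        rw [key]
        group
      rw [h1]
      exact mul_mem (mul_mem (inv_mem (hg σ)) ha) (inv_mem (scalar_mem_linearAut hw _))
    refine ⟨(σ, ⟨_, hmem⟩), Subtype.ext ?_⟩
    simp only [f]
    rw [key, map_mul _ (_ * _), ProjGenLinGroup.mk_scalar, mul_one]
  have := Nat.card_le_card_of_surjective f hf
  rwa [Nat.card_prod, Nat.card_eq_fintype_card (α := Equiv.Perm (Fin 3)), Fintype.card_perm,
    Fintype.card_fin] at this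

/-- A group of the second type permutes the coordinate axes in all possible ways. -/
theorem IsSecondType.exists_monomialGL_mem {d : ℕ} {w : VField} (hw : ∀ i, (w i).IsHomogeneous d)
    (h : IsSecondType (projAut w)) (τ : Equiv.Perm (Fin 3)) :
    ∃ s, monomialGL τ s ∈ linearAut w := by
  obtain ⟨μ, ν, hs⟩ := h.mk_swapMap_mem
  have hc := h.mk_cyclicMap_mem
  rw [mk_mem_projAut_iff hw, cyclicMap_eq] at hc
  rw [mk_mem_projAut_iff hw, swapMap_eq] at hs
  have hmul : ∀ σ τ : Equiv.Perm (Fin 3), (∃ s, monomialGL σ s ∈ linearAut w) →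
      (∃ s, monomialGL τ s ∈ linearAut w) → ∃ s, monomialGL (σ * τ) s ∈ linearAut w := by
    rintro σ τ ⟨s, hs⟩ ⟨t, ht⟩
    exact ⟨_, monomialGL_mul σ τ s t ▸ mul_mem hs ht⟩
  have h1 : ∃ s, monomialGL 1 s ∈ linearAut w := ⟨1, by rw [monomialGL_one]; exact one_mem _⟩
  have key : ∀ τ : Equiv.Perm (Fin 3), τ = 1 ∨ τ = Equiv.addRight 2 ∨
      τ = Equiv.addRight 2 * Equiv.addRight 2 ∨ τ = Equiv.swap 0 1 ∨
      τ = Equiv.swap 0 1 * Equiv.addRight 2 ∨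
      τ = Equiv.swap 0 1 * (Equiv.addRight 2 * Equiv.addRight 2) := by decide
  rcases key τ with rfl | rfl | rfl | rfl | rfl | rfl
  · exact h1
  · exact ⟨_, hc⟩
  · exact hmul _ _ ⟨_, hc⟩ ⟨_, hc⟩
  · exact ⟨_, hs⟩
  · exact hmul _ _ ⟨_, hs⟩ ⟨_, hc⟩
  · exact hmul _ _ ⟨_, hs⟩ (hmul _ _ ⟨_, hc⟩ ⟨_, hc⟩)

/-! ### Values of the field along the line at infinity. -/

theorem eval_compInv (φ : GL (Fin 3) ℂ) (f : MvPolynomial (Fin 3) ℂ) (p : Fin 3 → ℂ) :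
    eval p (compInv φ f) = eval (φ⁻¹.val *ᵥ p) f := by
  have h : (aeval p).comp (compInv φ) = (aeval (φ⁻¹.val *ᵥ p) :
      MvPolynomial (Fin 3) ℂ →ₐ[ℂ] ℂ) := by
    apply MvPolynomial.algHom_ext
    intro k
    rw [AlgHom.comp_apply, compInv_X]
    simp [Matrix.mulVec, dotProduct]
  exact DFunLike.congr_fun h f

theorem value_push (φ : GL (Fin 3) ℂ) (v : VField) (p : Fin 3 → ℂ) :
    (push φ v).value p = φ.val *ᵥ v.value (φ⁻¹.val *ᵥ p) := by
  ext i
  simp [VField.value, push, eval_compInv, Matrix.mulVec, dotProduct]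

theorem isHomogeneous_compInv (φ : GL (Fin 3) ℂ) {f : MvPolynomial (Fin 3) ℂ} {d : ℕ}
    (hf : f.IsHomogeneous d) : (compInv φ f).IsHomogeneous d := by
  have := hf.aeval (fun k => ∑ l, C (φ⁻¹.val k l) * X l : Fin 3 → MvPolynomial (Fin 3) ℂ)
    (n := 1) fun k => IsHomogeneous.sum _ _ _ fun l _ => isHomogeneous_C_mul_X _ _
  rwa [one_mul] at this

theorem isHomogeneous_push (φ : GL (Fin 3) ℂ) {v : VField} {d : ℕ}
    (hv : ∀ i, (v i).IsHomogeneous d) (i : Fin 3) : (push φ v i).IsHomogeneous d :=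
  IsHomogeneous.sum _ _ _ fun j _ => (isHomogeneous_compInv φ (hv j)).C_mul _

theorem infinityForm_dotProduct (ψ : GL (Fin 3) ℂ) (p : Fin 3 → ℂ) :
    infinityForm ψ ⬝ᵥ p = (ψ.val *ᵥ p) 2 := rfl

theorem mulVec_inv_mulVec (ψ : GL (Fin 3) ℂ) (p : Fin 3 → ℂ) :
    ψ.val *ᵥ (ψ⁻¹.val *ᵥ p) = p := by
  rw [Matrix.mulVec_mulVec, ← Units.val_mul, mul_inv_cancel, Units.val_one, Matrix.one_mulVec]

theorem inv_mulVec_mulVec (ψ : GL (Fin 3) ℂ) (p : Fin 3 → ℂ) :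
    ψ⁻¹.val *ᵥ (ψ.val *ᵥ p) = p := by
  rw [Matrix.mulVec_mulVec, ← Units.val_mul, inv_mul_cancel, Units.val_one, Matrix.one_mulVec]

theorem LineInvariant.eval_push_eq_zero {v : VField} {ψ : GL (Fin 3) ℂ}
    (h : LineInvariant v (infinityForm ψ)) {p : Fin 3 → ℂ} (hp : p 2 = 0) :
    eval p (push ψ v 2) = 0 := by
  have := h (ψ⁻¹.val *ᵥ p)
  rw [infinityForm_dotProduct, infinityForm_dotProduct, mulVec_inv_mulVec, ← value_push] at this
  exact this hp

theorem LineGenericallyTransverse.exists_eval_push_ne_zero {v : VField} {ψ : GL (Fin 3) ℂ}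
    (h : LineGenericallyTransverse v (infinityForm ψ)) :
    ∃ p : Fin 3 → ℂ, p 2 = 0 ∧ eval p (push ψ v 2) ≠ 0 := by
  obtain ⟨p, hp, hv⟩ := h
  refine ⟨ψ.val *ᵥ p, hp, ?_⟩
  change (push ψ v).value _ 2 ≠ 0
  rwa [value_push, inv_mulVec_mulVec]

/-- If the singularities are isolated, some point of the line at infinity is not singular. -/
theorem exists_not_singular {v : VField} (h : v.singularSet.Finite) (ψ : GL (Fin 3) ℂ) :
    ∃ p : Fin 3 → ℂ, p 2 = 0 ∧ ∀ c : ℂ, (push ψ v).value p ≠ c • p := by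
  have hne : ∀ t : ℂ, ψ⁻¹.val *ᵥ ![1, t, 0] ≠ 0 := by
    intro t h0
    have := congrFun (mulVec_inv_mulVec ψ ![1, t, 0]) 0
    rw [h0, Matrix.mulVec_zero] at this
    simp at this
  let q : ℂ → ℙ ℂ (Fin 3 → ℂ) := fun t => Projectivization.mk ℂ _ (hne t)
  have hq : Function.Injective q := by
    intro t t' ht
    obtain ⟨a, ha⟩ := (Projectivization.mk_eq_mk_iff' ℂ _ _ _ _).1 ht
    have h2 := congrArg (fun x => ψ.val *ᵥ x) ha
    simp only [Matrix.mulVec_smul, mulVec_inv_mulVec] at h2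
    have h0 := congrFun h2 0
    have h1 := congrFun h2 1
    simp at h0 h1
    rw [← h1, h0, one_mul]
  have : ∃ t, q t ∉ v.singularSet := by
    by_contra! hall
    exact Set.infinite_of_injective_forall_mem hq hall h
  obtain ⟨t, ht⟩ := this
  obtain ⟨a, ha⟩ := Projectivization.exists_smul_eq_mk_rep ℂ _ (hne t)
  refine ⟨ψ.val *ᵥ (q t).rep, ?_, fun c hc => ht ⟨c, ?_⟩⟩
  · rw [← ha, Units.smul_def, Matrix.mulVec_smul, mulVec_inv_mulVec]
    simp
  · rw [value_push, inv_mulVec_mulVec] at hc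
    have := congrArg (fun x => ψ⁻¹.val *ᵥ x) hc
    simpa only [Matrix.mulVec_smul, inv_mulVec_mulVec] using this

theorem exists_coeff_ne_zero_of_eval_ne_zero {f : MvPolynomial (Fin 3) ℂ} {p : Fin 3 → ℂ}
    {k : Fin 3} (hp : p k = 0) (h : eval p f ≠ 0) : ∃ m : Fin 3 →₀ ℕ, m k = 0 ∧ coeff m f ≠ 0 := by
  rw [eval_eq'] at h
  obtain ⟨m, hm, hne⟩ := Finset.exists_ne_zero_of_sum_ne_zero h
  refine ⟨m, ?_, mem_support_iff.1 hm⟩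
  by_contra hk
  refine hne (mul_eq_zero_of_right _ (Finset.prod_eq_zero (Finset.mem_univ k) ?_))
  rw [hp, zero_pow hk]

/-- A polynomial that vanishes on a coordinate plane is divisible by the coordinate. -/
theorem coeff_eq_zero_of_eval_eq_zero {f : MvPolynomial (Fin 3) ℂ} {k : Fin 3}
    (h : ∀ p : Fin 3 → ℂ, p k = 0 → eval p f = 0) {m : Fin 3 →₀ ℕ} (hm : m k = 0) :
    coeff m f = 0 := by
  have hr : f.modMonomial (Finsupp.single k 1) = 0 := by
    -- The remainder does not involve X k, so its value at p is its value at the projection of p to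
    -- the plane p k = 0, where f vanishes.
    refine MvPolynomial.funext fun p => ?_
    have h1 : eval (Function.update p k 0) (f.modMonomial (Finsupp.single k 1)) = 0 := by
      have := h (Function.update p k 0) (by simp)
      rw [← divMonomial_add_modMonomial_single f k] at this
      simpa using this
    rw [map_zero, ← h1, eval_eq', eval_eq']
    refine Finset.sum_congr rfl fun m' hm' => ?_
    congr 1
    refine Finset.prod_congr rfl fun i _ => ?_
    by_cases hi : i = k
    · subst hi
      have : m' i = 0 := by
        by_contra h0
        refine mem_support_iff.1 hm' (coeff_modMonomial_of_le f ?_)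
        rw [Finsupp.single_le_iff]
        lia
      simp [this]
    · rw [Function.update_of_ne hi]
  have := coeff_modMonomial_of_not_le (s := Finsupp.single k 1) (s' := m) f (by
    rw [Finsupp.single_le_iff]; lia)
  rw [hr, coeff_zero] at this
  exact this.symm

/-! ### Subgroups of μ_g × μ_g. -/

/-- A group of pairs of `g`-th roots of unity contains all of them or at most half of them. -/
theorem subgroup_prod_rootsOfUnity_dichotomy {g : ℕ} (hg : g ≠ 0) (D : Subgroup (ℂˣ × ℂˣ))
    (hD : ∀ p ∈ D, p.1 ^ g = 1 ∧ p.2 ^ g = 1) :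
    (Nat.card D = g ^ 2 ∧ ∀ p : ℂˣ × ℂˣ, p.1 ^ g = 1 → p.2 ^ g = 1 → p ∈ D) ∨
      2 * Nat.card D ≤ g ^ 2 := by
  have : NeZero g := ⟨hg⟩
  set E := (rootsOfUnity g ℂ).prod (rootsOfUnity g ℂ) with hE
  have hcard : Nat.card E = g ^ 2 := by
    rw [hE, Nat.card_congr (Subgroup.prodEquiv _ _).toEquiv, Nat.card_prod,
      Complex.card_rootsOfUnity, sq]
  have hle : D ≤ E := fun p hp => ⟨(hD p hp).1, (hD p hp).2⟩
  have hpos : 0 < g ^ 2 := by positivity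
  have hfin : Finite E := Nat.finite_of_card_ne_zero (by lia)
  obtain ⟨k, hk⟩ := Subgroup.card_dvd_of_le hle
  rw [hcard] at hk
  have h3 : k = 0 ∨ k = 1 ∨ 2 ≤ k := by lia
  rcases h3 with rfl | rfl | hk2
  · lia
  · left
    have : D = E := Subgroup.eq_of_le_of_card_ge hle (by rw [hcard, hk, mul_one])
    exact ⟨by lia, fun p h1 h2 => this ▸ ⟨h1, h2⟩⟩
  · right
    nlinarith

/-! ### Pure fields: a common form for the models F_d and G_d. -/

/-- The diagonal field `∑ k, X k ^ n • diag(Λ k)`. -/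
def pureField (n : ℕ) (Λ : Fin 3 → Fin 3 → ℂ) : VField :=
  fun i => X i * ∑ k, C (Λ k i) * X k ^ n

theorem push_monomialGL_pureField (n : ℕ) (Λ : Fin 3 → Fin 3 → ℂ) (σ : Equiv.Perm (Fin 3))
    (s : Fin 3 → ℂˣ) :
    push (monomialGL σ s) (pureField n Λ) =
      pureField n fun k i => Λ (σ⁻¹ k) (σ⁻¹ i) * ((s (σ⁻¹ k) : ℂ) ^ n)⁻¹ := by
  funext i
  obtain ⟨i, rfl⟩ := σ.surjective i
  rw [push_monomialGL, pureField, pureField, map_mul, compInv_monomialGL_X, ← mul_assoc,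
    ← mul_assoc, ← map_mul, Units.mul_inv, map_one, one_mul, map_sum]
  congr 1
  conv_rhs => rw [← Equiv.sum_comp σ]
  refine Finset.sum_congr rfl fun k _ => ?_
  rw [map_mul, compInv_C, map_pow, compInv_monomialGL_X, mul_pow, ← mul_assoc, ← map_pow,
    ← map_mul]
  simp

/-- If all monomial matrices with entries in the `g`-th roots of unity are automorphisms, then
there are at least `6 g²` automorphisms. -/
theorem le_card_projAut {g : ℕ} (hg : g ≠ 0) {w : VField} (hfin : Finite (projAut w))
    (h : ∀ (σ : Equiv.Perm (Fin 3)) (s : Fin 3 → ℂˣ), (∀ k, s k ^ g = 1) →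
      monomialGL σ s ∈ linearAut w) : 6 * g ^ 2 ≤ Nat.card (projAut w) := by
  have : NeZero g := ⟨hg⟩
  let f : Equiv.Perm (Fin 3) × rootsOfUnity g ℂ × rootsOfUnity g ℂ → projAut w := fun x =>
    ⟨ProjGenLinGroup.mk (monomialGL x.1 ![x.2.1, x.2.2, 1]), _, h _ _ (by
      have h1 : (x.2.1 : ℂˣ) ^ g = 1 := x.2.1.2
      have h2 : (x.2.2 : ℂˣ) ^ g = 1 := x.2.2.2
      intro k
      fin_cases k <;> simp [h1, h2]), rfl⟩
  have hf : Function.Injective f := by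
    intro x y hxy
    obtain ⟨h1, h2⟩ := mk_monomialGL_injective (by simp) (by simp) (congrArg Subtype.val hxy)
    refine Prod.ext h1 (Prod.ext (Subtype.ext ?_) (Subtype.ext ?_))
    · simpa using congrFun h2 0
    · simpa using congrFun h2 1
  have := Nat.card_le_card_of_injective f hf
  rw [Nat.card_prod, Nat.card_prod, Complex.card_rootsOfUnity,
    Nat.card_eq_fintype_card (α := Equiv.Perm (Fin 3)), Fintype.card_perm, Fintype.card_fin] at this
  rw [sq]
  exact this

theorem sameFoliation_pureField_smul (n : ℕ) (Λ : Fin 3 → Fin 3 → ℂ) {c : ℂ} (hc : c ≠ 0) :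
    SameFoliation (pureField n Λ) (pureField n fun k i => c * Λ k i) := by
  refine ⟨c, hc, 0, fun i => ?_⟩
  simp only [pureField, map_mul, mul_assoc, ← Finset.mul_sum]
  ring

/-- The diagonal coefficients of `fermatField` as a pure field. -/
def fermatSymbol (k i : Fin 3) : ℤ := if k = i then 1 else 0

/-- The diagonal coefficients of the pure field equivalent to `gField`. -/
def gSymbol : Fin 3 → Fin 3 → ℤ := ![![0, 1, -1], ![-1, 0, 1], ![1, -1, 0]]

theorem fermatField_eq (n : ℕ) :
    fermatField (n + 1) = pureField n fun k i => fermatSymbol k i := by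
  funext i
  fin_cases i <;> simp [fermatField, pureField, fermatSymbol, pow_succ']

theorem sameFoliation_gField (n : ℕ) :
    SameFoliation (pureField n fun k i => gSymbol k i) (gField (n + 1)) := by
  -- The radial multiple is the one that cancels the third component.
  refine ⟨-1, by simp, X 1 ^ n - X 0 ^ n, fun i => ?_⟩
  fin_cases i <;> simp [gField, pureField, gSymbol, Fin.sum_univ_three] <;> ring

/-- If the symbol `Λ` is invariant by permutations up to sign, then the pure field has the
monomial matrices with entries in the roots of unity as automorphisms. -/
theorem monomialGL_mem_linearAut_pureField (n : ℕ) (Λ : Fin 3 → Fin 3 → ℤ)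
    (hΛ : ∀ σ : Equiv.Perm (Fin 3), (∀ k i, Λ (σ k) (σ i) = Λ k i) ∨
      ∀ k i, Λ (σ k) (σ i) = - Λ k i) (σ : Equiv.Perm (Fin 3)) (s : Fin 3 → ℂˣ)
    (hs : ∀ k, s k ^ n = 1) :
    monomialGL σ s ∈ linearAut (pureField n fun k i => Λ k i) := by
  rw [mem_linearAut, push_monomialGL_pureField]
  have hs' : ∀ k, (s k : ℂ) ^ n = 1 := fun k => by
    rw [← Units.val_pow_eq_pow_val, hs, Units.val_one]
  simp only [hs', inv_one, mul_one]
  rcases hΛ σ⁻¹ with h | h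
  · simp only [h]
    exact SameFoliation.refl _
  · simp only [h]
    convert sameFoliation_pureField_smul n (fun k i => (Λ k i : ℂ)) (c := -1) (by simp) using 4
    push_cast
    ring

theorem isomorphic_of_sameFoliation_left {u v w : VField} (h : SameFoliation u v)
    (h' : Isomorphic v w) : Isomorphic u w := by
  obtain ⟨φ, h'⟩ := h'
  exact ⟨φ, (h.push φ).trans h'⟩

theorem le_card_projAut_of_isomorphic_pureField {n : ℕ} (hn : n ≠ 0) (Λ : Fin 3 → Fin 3 → ℤ)
    (hΛ : ∀ σ : Equiv.Perm (Fin 3), (∀ k i, Λ (σ k) (σ i) = Λ k i) ∨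
      ∀ k i, Λ (σ k) (σ i) = - Λ k i) {w : VField} (hfin : Finite (projAut w))
    (h : Isomorphic w (pureField n fun k i => Λ k i)) :
    6 * n ^ 2 ≤ Nat.card (projAut w) := by
  have hc := card_projAut_of_isomorphic h
  rw [← hc]
  refine le_card_projAut hn ?_ (monomialGL_mem_linearAut_pureField n Λ hΛ)
  -- `Nat.card` is 0 on infinite types, so a positive cardinality carries finiteness over to the
  -- model.
  refine Nat.finite_of_card_ne_zero ?_
  rw [hc]
  exact Nat.card_pos.ne'

theorem Isomorphic.pureField_of_gField {w : VField} {n : ℕ}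
    (h : Isomorphic w (gField (n + 1))) : Isomorphic w (pureField n fun k i => gSymbol k i) :=
  isomorphic_of_sameFoliation_right h (sameFoliation_gField n).symm

theorem fermatSymbol_perm : ∀ σ : Equiv.Perm (Fin 3),
    (∀ k i, fermatSymbol (σ k) (σ i) = fermatSymbol k i) ∨
      ∀ k i, fermatSymbol (σ k) (σ i) = - fermatSymbol k i := by decide

theorem gSymbol_perm : ∀ σ : Equiv.Perm (Fin 3),
    (∀ k i, gSymbol (σ k) (σ i) = gSymbol k i) ∨
      ∀ k i, gSymbol (σ k) (σ i) = - gSymbol k i := by decide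

theorem exists_units_pow_eq {n : ℕ} (hn : n ≠ 0) (c : Fin 3 → ℂ) (hc : ∀ k, c k ≠ 0) :
    ∃ s : Fin 3 → ℂˣ, ∀ k, (s k : ℂ) ^ n = c k := by
  choose z hz using fun k => IsAlgClosed.exists_pow_nat_eq (c k) (Nat.pos_of_ne_zero hn)
  have hz0 : ∀ k, z k ≠ 0 := fun k h0 => hc k (by rw [← hz k, h0, zero_pow hn])
  exact ⟨fun k => Units.mk0 (z k) (hz0 k), hz⟩

/-- Pushing by diag(s) divides the coefficients of X k ^ n by s k ^ n, and every c k has an n-th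
root. -/
theorem isomorphic_pureField_of_scaled {n : ℕ} (hn : n ≠ 0) (Λ : Fin 3 → Fin 3 → ℂ)
    (c : Fin 3 → ℂ) (hc : ∀ k, c k ≠ 0) :
    Isomorphic (pureField n fun k i => c k * Λ k i) (pureField n Λ) := by
  obtain ⟨s, hs⟩ := exists_units_pow_eq hn c hc
  refine ⟨monomialGL 1 s, ?_⟩
  rw [push_monomialGL_pureField]
  convert SameFoliation.refl (pureField n Λ) using 4 with k i
  simp only [inv_one, Equiv.Perm.coe_one, id_eq, hs]
  field_simp [hc k]

/-! ### Automorphisms of the model S. -/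

/-- Component j is the product of the variables other than X j. As s k is its own inverse, the
factor s j from the target and the inverses of the other two from the source combine to s 0 * s 1 *
s 2 for every j. -/
theorem push_monomialGL_sField (σ : Equiv.Perm (Fin 3)) (j : Fin 3) (s : Fin 3 → ℂˣ)
    (hs : ∀ k, s k ^ 2 = 1) :
    push (monomialGL σ s) sField (σ j) =
      C ((s 0 * s 1 * s 2 : ℂˣ) : ℂ) * sField (σ j) := by
  have hS : ∀ τ : Equiv.Perm (Fin 3), ∀ i,
      sField (τ i) = X (τ (i + 1)) * X (τ (i + 2)) := by
    have : ∀ τ : Equiv.Perm (Fin 3), ∀ i, (τ (i + 1) = τ i + 1 ∧ τ (i + 2) = τ i + 2) ∨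
      (τ (i + 1) = τ i + 2 ∧ τ (i + 2) = τ i + 1) := by decide
    intro τ i
    have h0 : ∀ i, sField i = X (i + 1) * X (i + 2) := by
      intro i
      fin_cases i <;> rfl
    rcases this τ i with ⟨h1, h2⟩ | ⟨h1, h2⟩
    · rw [h1, h2, h0]
    · rw [h1, h2, h0, mul_comm]
  have hinv : ∀ k, (s k)⁻¹ = s k := fun k => inv_eq_of_mul_eq_one_left (by rw [← sq, hs])
  have h1 := hS 1 j
  simp only [Equiv.Perm.coe_one, id_eq] at h1
  rw [push_monomialGL, h1, hS σ j, map_mul, compInv_monomialGL_X, compInv_monomialGL_X, hinv, hinv]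
  have : (s 0 * s 1 * s 2 : ℂˣ) = s j * s (j + 1) * s (j + 2) := by
    have h0 : (s 0 * s 1 * s 2 : ℂˣ) = ∏ k, s k := (Fin.prod_univ_three s).symm
    rw [h0, ← Equiv.prod_comp (Equiv.addLeft j), Fin.prod_univ_three]
    simp
  rw [this]
  simp only [Units.val_mul, map_mul]
  ring

theorem monomialGL_mem_linearAut_sField (σ : Equiv.Perm (Fin 3)) (s : Fin 3 → ℂˣ)
    (hs : ∀ k, s k ^ 2 = 1) : monomialGL σ s ∈ linearAut sField := by
  rw [mem_linearAut]
  refine ⟨((s 0 * s 1 * s 2 : ℂˣ) : ℂ), Units.ne_zero _, 0, fun i => ?_⟩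
  obtain ⟨j, rfl⟩ := σ.surjective i
  rw [push_monomialGL_sField σ j s hs]
  ring

/-! ### Invariant axes: coefficients modulo the radial field. -/

/-- The coordinate planes are invariant by the field `w`. -/
def AxesInvariant (w : VField) : Prop :=
  ∀ i (m : Fin 3 →₀ ℕ), m i = 0 → coeff m (w i) = 0

/-- The field `w` admits monomial automorphisms permuting the axes in all possible ways. -/
def FullySymmetric (w : VField) : Prop :=
  ∀ τ : Equiv.Perm (Fin 3), ∃ s, monomialGL τ s ∈ linearAut w

/-- The radial correction P * X (σ k) has no monomial free of X (σ k), so it drops out of these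
coefficients. -/
theorem exists_coeff_relation_of_apply_eq_zero {w : VField} {σ : Equiv.Perm (Fin 3)}
    {s : Fin 3 → ℂˣ} (h : monomialGL σ s ∈ linearAut w) :
    ∃ α : ℂˣ, ∀ k m, m k = 0 → s k * ((monomialValue s m)⁻¹ : ℂˣ) * coeff m (w k) =
      α * coeff (m.mapDomain σ) (w (σ k)) := by
  obtain ⟨α, hα, P, hP⟩ := exists_coeff_relation h
  refine ⟨Units.mk0 α hα, fun k m hm => ?_⟩
  rw [hP, coeff_mul_X', if_neg, add_zero, Units.val_mk0]
  rw [Finsupp.mem_support_iff, not_not, Finsupp.mapDomain_apply σ.injective, hm]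

theorem AxesInvariant.of_coeff {w : VField} (hsym : FullySymmetric w)
    (h : ∀ m : Fin 3 →₀ ℕ, m 2 = 0 → coeff m (w 2) = 0) : AxesInvariant w := by
  intro i m hm
  obtain ⟨s, hs⟩ := hsym (Equiv.swap i 2)
  obtain ⟨α, hα⟩ := exists_coeff_relation_of_apply_eq_zero hs
  have h2 : m.mapDomain (Equiv.swap i 2) 2 = 0 := by
    have := Finsupp.mapDomain_apply (Equiv.swap i 2).injective m i
    rwa [Equiv.swap_apply_left, hm] at this
  have := hα i m hm
  rw [Equiv.swap_apply_left, h _ h2, mul_zero] at this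
  simpa using this

/-- The coefficients of the quotient of the `i`-th component of `w` by the `i`-th variable. -/
def quotCoeff (w : VField) (i : Fin 3) (m : Fin 3 →₀ ℕ) : ℂ := coeff (Finsupp.single i 1 + m) (w i)

/-- The exponents that occur in `w` modulo the multiples of the radial field. -/
def exponents (w : VField) : Set (Fin 3 →₀ ℕ) := {m | ∃ i j, quotCoeff w i m ≠ quotCoeff w j m}

theorem AxesInvariant.eq_X_mul {w : VField} (h : AxesInvariant w) (i : Fin 3) :
    w i = X i * (w i).divMonomial (Finsupp.single i 1) := by
  have hr : (w i).modMonomial (Finsupp.single i 1) = 0 := by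
    ext m
    rw [coeff_zero]
    by_cases hm : Finsupp.single i 1 ≤ m
    · exact coeff_modMonomial_of_le _ hm
    · rw [coeff_modMonomial_of_not_le _ hm]
      rw [Finsupp.single_le_iff] at hm
      exact h i m (by lia)
  conv_lhs => rw [← divMonomial_add_modMonomial_single (w i) i, hr, add_zero]

/-- After division by the variables, the radial term contributes the same coefficient of P to every
component; differences of components do not see it. -/
theorem quotCoeff_relation {w : VField} {σ : Equiv.Perm (Fin 3)} {s : Fin 3 → ℂˣ}
    (h : monomialGL σ s ∈ linearAut w) (m : Fin 3 →₀ ℕ) :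
    ∃ γ : ℂˣ, ∀ i j, quotCoeff w (σ i) (m.mapDomain σ) - quotCoeff w (σ j) (m.mapDomain σ) =
      γ * (quotCoeff w i m - quotCoeff w j m) := by
  obtain ⟨α, hα, P, hP⟩ := exists_coeff_relation h
  have key : ∀ i, ((monomialValue s m)⁻¹ : ℂˣ) * quotCoeff w i m =
      α * quotCoeff w (σ i) (m.mapDomain σ) + coeff (m.mapDomain σ) P := by
    intro i
    have := hP i (Finsupp.single i 1 + m)
    rw [Finsupp.mapDomain_add, Finsupp.mapDomain_single, add_comm (Finsupp.single (σ i) 1),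
      coeff_mul_X, monomialValue_add, monomialValue_single, pow_one, mul_inv, Units.val_mul,
      ← mul_assoc, Units.mul_inv, one_mul] at this
    rw [quotCoeff, this, quotCoeff, add_comm (Finsupp.single (σ i) 1)]
  refine ⟨(Units.mk0 α hα)⁻¹ * (monomialValue s m)⁻¹, fun i j => ?_⟩
  have h1 := key i
  have h2 := key j
  rw [Units.val_mul, mul_assoc, mul_sub, h1, h2, Units.val_inv_eq_inv_val, Units.val_mk0]
  field_simp
  ring

/-- The proportionality factor α does not depend on the monomial. Where some difference of quotient
coefficients is nonzero it can be cancelled, leaving the value α⁻¹. -/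
theorem diagonal_quotCoeff_relation {w : VField} {s : Fin 3 → ℂˣ}
    (h : monomialGL 1 s ∈ linearAut w) :
    ∃ κ : ℂˣ, ∀ m ∈ exponents w, monomialValue s m = κ := by
  obtain ⟨α, hα, P, hP⟩ := exists_coeff_relation h
  have key : ∀ m i, ((monomialValue s m)⁻¹ : ℂˣ) * quotCoeff w i m =
      α * quotCoeff w i m + coeff m P := by
    intro m i
    have := hP i (m + Finsupp.single i 1)
    rw [Equiv.Perm.coe_one, Finsupp.mapDomain_id, id_eq,
      coeff_mul_X, monomialValue_add, monomialValue_single, pow_one, mul_comm (monomialValue s m),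
      mul_inv, Units.val_mul, ← mul_assoc, Units.mul_inv, one_mul] at this
    rw [quotCoeff, add_comm, this]
  refine ⟨(Units.mk0 α hα)⁻¹, fun m hm => ?_⟩
  obtain ⟨i, j, hij⟩ := hm
  rw [← _root_.inv_inj, inv_inv]
  apply Units.ext
  rw [Units.val_mk0]
  apply mul_right_cancel₀ (sub_ne_zero.2 hij)
  linear_combination key m i - key m j

theorem mapDomain_mem_exponents {w : VField} {σ : Equiv.Perm (Fin 3)} {s : Fin 3 → ℂˣ}
    (h : monomialGL σ s ∈ linearAut w) {m : Fin 3 →₀ ℕ} (hm : m ∈ exponents w) :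
    m.mapDomain σ ∈ exponents w := by
  obtain ⟨i, j, hij⟩ := hm
  obtain ⟨γ, hγ⟩ := quotCoeff_relation h m
  refine ⟨σ i, σ j, ?_⟩
  rw [← sub_ne_zero, hγ]
  exact mul_ne_zero γ.ne_zero (sub_ne_zero.2 hij)

theorem coeff_sum_C_mul_X_pow (n : ℕ) (c : Fin 3 → ℂ) (m : Fin 3 →₀ ℕ) :
    coeff m (∑ k, C (c k) * X k ^ n : MvPolynomial (Fin 3) ℂ) =
      ∑ k, if Finsupp.single k n = m then c k else 0 := by
  rw [coeff_sum]
  refine Finset.sum_congr rfl fun k _ => ?_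
  rw [coeff_C_mul, coeff_X_pow]
  split_ifs <;> simp

/-- A field with only pure exponents is a pure field, modulo the radial field. -/
theorem sameFoliation_pureField {w : VField} (hax : AxesInvariant w) {n : ℕ} (hn : n ≠ 0)
    (hpure : ∀ m ∈ exponents w, ∃ k, m = Finsupp.single k n) :
    SameFoliation w (pureField n fun k i => quotCoeff w i (Finsupp.single k n)) := by
  set Q : Fin 3 → MvPolynomial (Fin 3) ℂ := fun i => (w i).divMonomial (Finsupp.single i 1) with hQ
  set R : Fin 3 → MvPolynomial (Fin 3) ℂ :=
    fun i => ∑ k, C (quotCoeff w i (Finsupp.single k n)) * X k ^ n with hR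
  -- The discrepancy is independent of the component, hence a multiple of the radial field.
  have key : ∀ i, Q i - R i = Q 0 - R 0 := by
    intro i
    ext m
    have hQm : ∀ i, coeff m (Q i) = quotCoeff w i m := fun i => coeff_divMonomial _ _ _
    rw [coeff_sub, coeff_sub, hQm, hQm]
    simp only [hR, coeff_sum_C_mul_X_pow]
    by_cases hm : ∃ k, m = Finsupp.single k n
    · obtain ⟨k, rfl⟩ := hm
      simp [Finsupp.single_left_inj hn]
    · have h1 : ∀ k, Finsupp.single k n ≠ m := fun k hk => hm ⟨k, hk.symm⟩
      simp only [h1, if_false, Finset.sum_const_zero, sub_zero]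
      by_contra hne
      exact hm (hpure m ⟨_, _, hne⟩)
  refine ⟨1, one_ne_zero, R 0 - Q 0, fun i => ?_⟩
  conv_rhs => rw [hax.eq_X_mul i]
  change X i * R i = C 1 * (X i * Q i) + _
  rw [map_one]
  linear_combination (- X i) * key i

/-- Adding a constant to row k of Λ adds a multiple of X k ^ n times the radial field. -/
theorem sameFoliation_pureField_of_sub_eq {n : ℕ} {Λ Λ' : Fin 3 → Fin 3 → ℂ}
    (h : ∀ k i j, Λ k i - Λ k j = Λ' k i - Λ' k j) :
    SameFoliation (pureField n Λ) (pureField n Λ') := by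
  refine ⟨1, one_ne_zero, ∑ k, C (Λ' k 0 - Λ k 0) * X k ^ n, fun i => ?_⟩
  rw [map_one, one_mul, pureField, pureField, mul_comm _ (X i), ← mul_add,
    ← Finset.sum_add_distrib]
  congr 1
  refine Finset.sum_congr rfl fun k _ => ?_
  rw [← add_mul, ← map_add]
  congr 2
  linear_combination - h k i 0

/-! ### Symmetric pure fields are F_d or G_d. -/

/-- The classification of the symmetric foliations with pure exponents. -/
theorem isomorphic_of_pure {w : VField} (hax : AxesInvariant w) (hsym : FullySymmetric w)
    {n : ℕ} (hn : n ≠ 0) (hne : (exponents w).Nonempty)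
    (hpure : ∀ m ∈ exponents w, ∃ k, m = Finsupp.single k n) :
    Isomorphic w (fermatField (n + 1)) ∨ Isomorphic w (gField (n + 1)) := by
  have hsame := sameFoliation_pureField hax hn hpure
  set Λ : Fin 3 → Fin 3 → ℂ := fun k i => quotCoeff w i (Finsupp.single k n) with hΛ
  have hrel : ∀ (τ : Equiv.Perm (Fin 3)) k, ∃ γ : ℂˣ, ∀ i j,
      Λ (τ k) (τ i) - Λ (τ k) (τ j) = γ * (Λ k i - Λ k j) := by
    intro τ k
    obtain ⟨s, hs⟩ := hsym τ
    obtain ⟨γ, hγ⟩ := quotCoeff_relation hs (Finsupp.single k n)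
    rw [Finsupp.mapDomain_single] at hγ
    exact ⟨γ, hγ⟩
  have hne2 : ∃ i j, Λ 2 i ≠ Λ 2 j := by
    obtain ⟨m, hm⟩ := hne
    obtain ⟨k, rfl⟩ := hpure m hm
    obtain ⟨s, hs⟩ := hsym (Equiv.swap k 2)
    have := mapDomain_mem_exponents hs hm
    rwa [Finsupp.mapDomain_single, Equiv.swap_apply_left] at this
  -- A cyclically symmetric symbol is determined by row 2. Automorphisms over the cyclic
  -- permutations carry row 2 of Λ to row k up to a factor γ k, which a diagonal change of
  -- coordinates absorbs.
  have hfin : ∀ S : Fin 3 → Fin 3 → ℤ,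
      (∀ k i, S k i = S 2 (i + 2 - k)) →
      (∃ c : ℂ, c ≠ 0 ∧ ∀ i j, Λ 2 i - Λ 2 j = c * (S 2 i - S 2 j)) →
      Isomorphic w (pureField n fun k i => S k i) := by
    rintro S hS ⟨c, hc, h2⟩
    choose γ hγ using fun k : Fin 3 => hrel (Equiv.addRight (k + 1)) 2
    have h3 : SameFoliation (pureField n Λ) (pureField n fun k i => (γ k * c) * S k i) := by
      refine sameFoliation_pureField_of_sub_eq fun k i j => ?_
      have h := hγ k (i + 2 - k) (j + 2 - k)
      have e : ∀ k i : Fin 3, i + 2 - k + (k + 1) = i := by decide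
      have e' : ∀ k : Fin 3, 2 + (k + 1) = k := by decide
      simp only [Equiv.coe_addRight, e, e'] at h
      rw [h, h2, hS k i, hS k j]
      ring
    exact isomorphic_of_sameFoliation_left (hsame.trans h3)
      (isomorphic_pureField_of_scaled hn _ _ fun k => mul_ne_zero (γ k).ne_zero hc)
  -- This transposition keeps row 2 and exchanges its first two entries: either they are equal,
  -- which gives F_d, or β = -1, which makes the row proportional to (1, -1, 0) modulo constants and
  -- gives G_d.
  obtain ⟨β, hβ⟩ := hrel (Equiv.swap 0 1) 2
  have e2 : Equiv.swap (0 : Fin 3) 1 2 = 2 := by decide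
  have e0 : Equiv.swap (0 : Fin 3) 1 0 = 1 := by decide
  have e1 : Equiv.swap (0 : Fin 3) 1 1 = 0 := by decide
  have hβ1 := hβ 0 1
  have hβ2 := hβ 0 2
  rw [e2, e0, e1] at hβ1
  rw [e2, e0] at hβ2
  by_cases h01 : Λ 2 0 = Λ 2 1
  · left
    rw [fermatField_eq]
    refine hfin _ (by decide) ⟨Λ 2 2 - Λ 2 0, ?_, fun i j => ?_⟩
    · intro h
      obtain ⟨i, j, hij⟩ := hne2
      rw [sub_eq_zero] at h
      refine hij ?_
      fin_cases i <;> fin_cases j <;> simp_all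
    · fin_cases i <;> fin_cases j <;> simp [fermatSymbol, h01]
  · right
    have hβ' : (β : ℂ) = -1 := by
      have : Λ 2 0 - Λ 2 1 ≠ 0 := sub_ne_zero.2 h01
      apply mul_right_cancel₀ this
      linear_combination - hβ1
    rw [hβ'] at hβ2
    refine isomorphic_of_sameFoliation_right (hfin gSymbol (by decide) ⟨Λ 2 0 - Λ 2 2, ?_, ?_⟩)
      (sameFoliation_gField n)
    · intro h
      exact h01 (by linear_combination 2 * h - hβ2)
    · intro i j
      fin_cases i <;> fin_cases j <;> simp [gSymbol] <;>
        first | linear_combination hβ2 | linear_combination -hβ2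

/-! ### Invariant line: bounds on the group. -/

theorem sum_eq_of_mem_exponents {w : VField} {n : ℕ} (hw : ∀ i, (w i).IsHomogeneous (n + 1))
    {m : Fin 3 →₀ ℕ} (hm : m ∈ exponents w) : m 0 + m 1 + m 2 = n := by
  obtain ⟨i, j, hij⟩ := hm
  have : ∃ i, quotCoeff w i m ≠ 0 := by
    by_contra! h
    exact hij (by rw [h, h])
  obtain ⟨i, hi⟩ := this
  have := degree_eq_of_coeff_ne_zero (hw i) hi
  simp only [Finsupp.add_apply] at this
  fin_cases i <;> simp at this <;> lia

/-- If some point of the line `Z = 0` is not singular, then an exponent without `Z` occurs. -/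
theorem exists_mem_exponents {w : VField} (hax : AxesInvariant w) {p : Fin 3 → ℂ} (hp : p 2 = 0)
    (hsing : ∀ c : ℂ, w.value p ≠ c • p) : ∃ m ∈ exponents w, m 2 = 0 := by
  by_contra! h
  set Q : Fin 3 → MvPolynomial (Fin 3) ℂ := fun i => (w i).divMonomial (Finsupp.single i 1) with hQ
  -- Were all exponents divisible by Z, Q 0 and Q 1 would agree at p; since p 2 = 0, the field would
  -- be radial there.
  have h01 : eval p (Q 1 - Q 0) = 0 := by
    by_contra h0
    obtain ⟨m, hm, hne⟩ := exists_coeff_ne_zero_of_eval_ne_zero hp h0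
    exact h m ⟨1, 0, by rwa [coeff_sub, sub_ne_zero] at hne⟩ hm
  refine hsing (eval p (Q 0)) ?_
  have hv : ∀ i, w.value p i = p i * eval p (Q i) := by
    intro i
    rw [VField.value, hax.eq_X_mul i, map_mul, eval_X]
  rw [map_sub, sub_eq_zero] at h01
  ext i
  rw [hv]
  fin_cases i
  · simp [mul_comm]
  · simp [mul_comm, h01]
  · simp [hp]

theorem exists_prod_pow_eq {w : VField} (hsym : FullySymmetric w) {p : ℂˣ × ℂˣ}
    (hp : p ∈ diagonalAut w) : ∃ κ : ℂˣ, ∀ m ∈ exponents w, ∀ τ : Equiv.Perm (Fin 3),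
      (![p.1, p.2, 1] (τ 0)) ^ m 0 * (![p.1, p.2, 1] (τ 1)) ^ m 1 *
        (![p.1, p.2, 1] (τ 2)) ^ m 2 = κ := by
  obtain ⟨κ, hκ⟩ := diagonal_quotCoeff_relation (mem_diagonalAut.1 hp)
  refine ⟨κ, fun m hm τ => ?_⟩
  obtain ⟨s, hs⟩ := hsym τ
  rw [← hκ _ (mapDomain_mem_exponents hs hm), monomialValue_mapDomain, Fin.prod_univ_three]

/-- Write (x, y) = p, a = m 0, b = m 1. Permuting X^a Y^b gives x^a y^b = x^a = y^b = κ, so κ = 1,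
and then also x^b = y^a = 1. -/
theorem pow_eq_one_of_mem_diagonalAut {w : VField} (hsym : FullySymmetric w)
    {m : Fin 3 →₀ ℕ} (hm : m ∈ exponents w) (hm2 : m 2 = 0) {p : ℂˣ × ℂˣ}
    (hp : p ∈ diagonalAut w) :
    (p.1 ^ (m 0).gcd (m 1) = 1 ∧ p.2 ^ (m 0).gcd (m 1) = 1) ∧
      ∀ m' ∈ exponents w, p.1 ^ m' 0 * p.2 ^ m' 1 = 1 := by
  obtain ⟨κ, hκ⟩ := exists_prod_pow_eq hsym hp
  have h1 := hκ m hm 1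
  have h2 := hκ m hm (Equiv.swap 0 2)
  have h3 := hκ m hm (Equiv.swap 1 2)
  have h4 := hκ m hm (Equiv.addRight 1)
  have h5 := hκ m hm (Equiv.addRight 2)
  have e1 : Equiv.swap (0 : Fin 3) 2 1 = 1 := by decide
  have e2 : Equiv.swap (1 : Fin 3) 2 0 = 0 := by decide
  have e3 : (1 : Fin 3) + 1 = 2 := by decide
  have e4 : (1 : Fin 3) + 2 = 0 := by decide
  simp [hm2, e1, e2, e3, e4] at h1 h2 h3 h4 h5
  have hκ1 : κ = 1 := by
    rw [h3, h2] at h1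
    exact mul_eq_left.1 h1
  subst hκ1
  refine ⟨⟨pow_gcd_eq_one.2 ⟨h3, h5⟩, pow_gcd_eq_one.2 ⟨h4, h2⟩⟩, fun m' hm' => ?_⟩
  have := hκ m' hm' 1
  simpa using this

theorem exists_isPrimitiveRoot_units {n : ℕ} (hn : n ≠ 0) : ∃ ζ : ℂˣ, IsPrimitiveRoot ζ n := by
  have h := Complex.isPrimitiveRoot_exp n hn
  exact ⟨(h.isUnit hn).unit, h.isUnit_unit hn⟩

/-- If the diagonal automorphisms contain all pairs of `n`-th roots of unity, then the exponents
are pure. -/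
theorem eq_single_of_mem_exponents {w : VField} {n : ℕ} (hn : n ≠ 0)
    (hw : ∀ i, (w i).IsHomogeneous (n + 1))
    (hfull : ∀ p : ℂˣ × ℂˣ, p.1 ^ n = 1 → p.2 ^ n = 1 → p ∈ diagonalAut w)
    (hone : ∀ p ∈ diagonalAut w, ∀ m ∈ exponents w, p.1 ^ m 0 * p.2 ^ m 1 = 1)
    {m : Fin 3 →₀ ℕ} (hm : m ∈ exponents w) : ∃ k, m = Finsupp.single k n := by
  obtain ⟨ζ, hζ⟩ := exists_isPrimitiveRoot_units hn
  -- Testing on (ζ, 1) and (1, ζ) shows that n divides m 0 and m 1, whose sum is at most n.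
  have h0 := hone (ζ, 1) (hfull _ hζ.pow_eq_one (one_pow _)) m hm
  have h1 := hone (1, ζ) (hfull _ (one_pow _) hζ.pow_eq_one) m hm
  simp only [one_pow, mul_one, one_mul] at h0 h1
  obtain ⟨a, ha⟩ := hζ.dvd_of_pow_eq_one _ h0
  obtain ⟨b, hb⟩ := hζ.dvd_of_pow_eq_one _ h1
  have hs := sum_eq_of_mem_exponents hw hm
  have hab : n * (a + b) ≤ n * 1 := by
    rw [mul_add, ← ha, ← hb]
    lia
  have hab := Nat.le_of_mul_le_mul_left hab (Nat.pos_of_ne_zero hn)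
  have h3 : (a = 0 ∧ b = 0) ∨ (a = 1 ∧ b = 0) ∨ (a = 0 ∧ b = 1) := by lia
  rcases h3 with ⟨rfl, rfl⟩ | ⟨rfl, rfl⟩ | ⟨rfl, rfl⟩
  · exact ⟨2, by ext i; fin_cases i <;> simp <;> lia⟩
  · exact ⟨0, by ext i; fin_cases i <;> simp <;> lia⟩
  · exact ⟨1, by ext i; fin_cases i <;> simp <;> lia⟩

/-- For n = 0 the field is linear and diagonal, hence preserved by the infinite diagonal torus. -/
theorem ne_zero_of_axesInvariant {w : VField} {n : ℕ} (hw : ∀ i, (w i).IsHomogeneous (n + 1))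
    (hfin : Finite (projAut w)) (hax : AxesInvariant w) : n ≠ 0 := by
  rintro rfl
  have hw' : ∀ i, ∃ c : ℂ, w i = X i * C c := by
    intro i
    refine ⟨coeff 0 ((w i).divMonomial (Finsupp.single i 1)), ?_⟩
    conv_lhs => rw [hax.eq_X_mul i]
    congr 1
    ext m
    rw [coeff_C]
    split_ifs with h
    · rw [h]
    · rw [coeff_divMonomial]
      by_contra hne
      refine h ?_
      have := degree_eq_of_coeff_ne_zero (hw i) hne
      simp only [Finsupp.add_apply] at this
      ext k
      fin_cases i <;> fin_cases k <;> simp at this ⊢ <;> lia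
  have hD : ∀ p, p ∈ diagonalAut w := by
    intro p
    rw [mem_diagonalAut, mem_linearAut]
    convert SameFoliation.refl w using 1
    funext i
    obtain ⟨c, hc⟩ := hw' i
    have := push_monomialGL 1 ![p.1, p.2, 1] w i
    rw [Equiv.Perm.coe_one, id_eq] at this
    rw [this, hc, map_mul, compInv_C, compInv_monomialGL_X, ← mul_assoc, ← mul_assoc, ← map_mul,
      Units.mul_inv, map_one, one_mul]
    rfl
  have := finite_diagonalAut hfin
  have hinf : Infinite ℂˣ := by
    refine Infinite.of_injective (fun k : ℕ => (Units.mk0 ((k : ℂ) + 1) (Nat.cast_add_one_ne_zero k))) ?_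
    intro a b hab
    have := congrArg Units.val hab
    simpa using this
  have hinj : Function.Injective fun a : ℂˣ => (⟨(a, 1), hD _⟩ : diagonalAut w) := by
    intro a b hab
    simpa using hab
  exact not_finite_iff_infinite.2 hinf (Finite.of_injective _ hinj)

theorem card_projAut_of_axesInvariant {w : VField} {n : ℕ}
    (hw : ∀ i, (w i).IsHomogeneous (n + 1)) (hfin : Finite (projAut w))
    (hmon : projAut w ≤ monomialSubgroup) (hsym : FullySymmetric w) (hax : AxesInvariant w)
    (hne : ∃ m ∈ exponents w, m 2 = 0) :
    Nat.card (projAut w) ≤ 6 * n ^ 2 ∧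
      (Isomorphic w (fermatField (n + 1)) ∨ Isomorphic w (gField (n + 1)) ∨
        Nat.card (projAut w) ≤ 3 * n ^ 2) := by
  have hn := ne_zero_of_axesInvariant hw hfin hax
  have hcard := card_projAut_le hw hfin hmon
  obtain ⟨m, hm, hm2⟩ := hne
  have hsum := sum_eq_of_mem_exponents hw hm
  rw [hm2, add_zero] at hsum
  have hg : (m 0).gcd (m 1) ≠ 0 := by
    rw [Ne, Nat.gcd_eq_zero_iff]
    lia
  have hdich := subgroup_prod_rootsOfUnity_dichotomy hg (diagonalAut w)
    fun p hp => (pow_eq_one_of_mem_diagonalAut hsym hm hm2 hp).1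
  by_cases hpos : m 0 ≠ 0 ∧ m 1 ≠ 0
  · have h0 := Nat.gcd_le_left (m 1) (Nat.pos_of_ne_zero hpos.1)
    have h1 := Nat.gcd_le_right (m 0) (Nat.pos_of_ne_zero hpos.2)
    -- Two positive multiples of the gcd sum to n, so the gcd is at most n / 2.
    have hD : 4 * Nat.card (diagonalAut w) ≤ n ^ 2 := by
      have hle : Nat.card (diagonalAut w) ≤ (m 0).gcd (m 1) ^ 2 := by
        rcases hdich with ⟨h, _⟩ | h
        · exact h.le
        · lia
      have : 2 * (m 0).gcd (m 1) ≤ n := by lia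
      have := Nat.pow_le_pow_left this 2
      rw [mul_pow] at this
      lia
    exact ⟨by lia, .inr (.inr (by lia))⟩
  · have hgn : (m 0).gcd (m 1) = n := by
      rcases not_and_or.1 hpos with h | h <;> rw [not_not] at h <;> rw [h] at hsum ⊢ <;> simp_all
    rw [hgn] at hdich
    rcases hdich with ⟨h, hfull⟩ | h
    · refine ⟨by lia, ?_⟩
      have := isomorphic_of_pure hax hsym hn ⟨m, hm⟩ fun m' hm' =>
        eq_single_of_mem_exponents hn hw hfull
          (fun p hp => (pow_eq_one_of_mem_diagonalAut hsym hm hm2 hp).2) hm'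
      tauto
    · exact ⟨by lia, .inr (.inr (by lia))⟩

/-! ### Transverse line: constraints on diagonal automorphisms. -/

theorem coeff_mapDomain_ne_zero {w : VField} {σ : Equiv.Perm (Fin 3)} {s : Fin 3 → ℂˣ}
    (h : monomialGL σ s ∈ linearAut w) {k : Fin 3} {m : Fin 3 →₀ ℕ} (hm : m k = 0)
    (hc : coeff m (w k) ≠ 0) : coeff (m.mapDomain σ) (w (σ k)) ≠ 0 := by
  obtain ⟨α, hα⟩ := exists_coeff_relation_of_apply_eq_zero h
  have h1 : s k * ((monomialValue s m)⁻¹ : ℂˣ) * coeff m (w k) ≠ 0 :=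
    mul_ne_zero (mul_ne_zero (s k).ne_zero (Units.ne_zero _)) hc
  rw [hα k m hm] at h1
  exact right_ne_zero_of_mul h1

/-- Every permuted copy of the monomial occurs in the corresponding component and is free of that
component's variable, so all copies are scaled by the same α. -/
theorem exists_eq_mul_prod_pow {w : VField} (hsym : FullySymmetric w) {m : Fin 3 →₀ ℕ}
    (hm : m 2 = 0) (hc : coeff m (w 2) ≠ 0) {p : ℂˣ × ℂˣ} (hp : p ∈ diagonalAut w) :
    ∃ κ : ℂˣ, ∀ τ : Equiv.Perm (Fin 3), ![p.1, p.2, 1] (τ 2) =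
      κ * ((![p.1, p.2, 1] (τ 0)) ^ m 0 * (![p.1, p.2, 1] (τ 1)) ^ m 1) := by
  obtain ⟨α, hα⟩ := exists_coeff_relation_of_apply_eq_zero (mem_diagonalAut.1 hp)
  refine ⟨α, fun τ => ?_⟩
  obtain ⟨s, hs⟩ := hsym τ
  have hc' := coeff_mapDomain_ne_zero hs hm hc
  have h := hα (τ 2) (m.mapDomain τ) (by rw [Finsupp.mapDomain_apply τ.injective, hm])
  rw [Equiv.Perm.coe_one, Finsupp.mapDomain_id, id_eq] at h
  have h2 := mul_right_cancel₀ hc' h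
  rw [← Units.val_mul, Units.val_inj, mul_inv_eq_iff_eq_mul, monomialValue_mapDomain,
    Fin.prod_univ_three, hm, pow_zero, mul_one] at h2
  exact h2

/-- Write (x, y) = p, a = m 0, b = m 1. From x = κ y^b and 1 = κ x^a y^b follows x^(a+1) = 1; the
other relations come from permuting x, y, 1. -/
theorem pow_eq_one_of_transverse {w : VField} (hsym : FullySymmetric w) {m : Fin 3 →₀ ℕ}
    (hm : m 2 = 0) (hc : coeff m (w 2) ≠ 0) {p : ℂˣ × ℂˣ} (hp : p ∈ diagonalAut w) :
    p.1 ^ (m 0 + 1).gcd (m 1 + 1) = 1 ∧ p.2 ^ (m 0 + 1).gcd (m 1 + 1) = 1 := by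
  obtain ⟨κ, hκ⟩ := exists_eq_mul_prod_pow hsym hm hc hp
  have h1 := hκ 1
  have h2 := hκ (Equiv.swap 0 2)
  have h3 := hκ (Equiv.swap 1 2)
  have h4 := hκ (Equiv.addRight 1)
  have h5 := hκ (Equiv.addRight 2)
  have h6 := hκ (Equiv.swap 0 1)
  have e1 : Equiv.swap (0 : Fin 3) 2 1 = 1 := by decide
  have e2 : Equiv.swap (1 : Fin 3) 2 0 = 0 := by decide
  have e3 : (1 : Fin 3) + 1 = 2 := by decide
  have e4 : (1 : Fin 3) + 2 = 0 := by decide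
  have e5 : (2 : Fin 3) + 1 = 0 := by decide
  have e6 : (2 : Fin 3) + 2 = 1 := by decide
  have e7 : Equiv.swap (0 : Fin 3) 1 2 = 2 := by decide
  simp [e1, e2, e3, e4, e5, e6, e7] at h1 h2 h3 h4 h5 h6
  have key : ∀ {x y : ℂˣ} {k l : ℕ}, x = κ * y ^ l → 1 = κ * (x ^ k * y ^ l) → x ^ (k + 1) = 1 := by
    intro x y k l hx hxy
    rw [hxy, pow_succ, mul_left_comm, ← hx]
  exact ⟨pow_gcd_eq_one.2 ⟨key h2 h1, key h4 (by rw [h6, mul_comm (p.2 ^ _)])⟩,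
    pow_gcd_eq_one.2 ⟨key h5 h6, key h3 (by rw [h1, mul_comm (p.1 ^ _)])⟩⟩

/-! ### Quadratic fields and the recognition of S. -/

/-- The expansion of a quadratic form in three variables. -/
theorem quadratic_eq {f : MvPolynomial (Fin 3) ℂ} (hf : f.IsHomogeneous 2) :
    f = C (coeff (Finsupp.single 0 1 + Finsupp.single 0 1) f) * (X 0 * X 0) +
      C (coeff (Finsupp.single 1 1 + Finsupp.single 1 1) f) * (X 1 * X 1) +
      C (coeff (Finsupp.single 2 1 + Finsupp.single 2 1) f) * (X 2 * X 2) +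
      C (coeff (Finsupp.single 0 1 + Finsupp.single 1 1) f) * (X 0 * X 1) +
      C (coeff (Finsupp.single 1 1 + Finsupp.single 2 1) f) * (X 1 * X 2) +
      C (coeff (Finsupp.single 2 1 + Finsupp.single 0 1) f) * (X 2 * X 0) := by
  have hX : ∀ i j : Fin 3, (X i * X j : MvPolynomial (Fin 3) ℂ) =
      monomial (Finsupp.single i 1 + Finsupp.single j 1) 1 := by
    intro i j
    rw [X, X, monomial_mul, one_mul]
  have hne : ∀ {i j i' j' : Fin 3}, Finsupp.single i 1 + Finsupp.single j 1 =
      (Finsupp.single i' 1 + Finsupp.single j' 1 : Fin 3 →₀ ℕ) →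
      (i = i' ∧ j = j') ∨ (i = j' ∧ j = i') := by
    intro i j i' j' h
    have h0 := DFunLike.congr_fun h 0
    have h1 := DFunLike.congr_fun h 1
    have h2 := DFunLike.congr_fun h 2
    revert h0 h1 h2
    fin_cases i <;> fin_cases j <;> fin_cases i' <;> fin_cases j' <;> simp
  ext m
  simp only [hX, coeff_add, coeff_C_mul, coeff_monomial]
  by_cases hm : coeff m f = 0
  · rw [hm]
    have : ∀ m', coeff m' f * (if m' = m then 1 else 0) = 0 := by
      intro m'
      split_ifs with h
      · rw [h, hm, zero_mul]
      · rw [mul_zero]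
    simp only [this, add_zero]
  · have hd := degree_eq_of_coeff_ne_zero hf hm
    have hex : ∃ i j : Fin 3, m = Finsupp.single i 1 + Finsupp.single j 1 ∧
        ((i = 0 ∧ j = 0) ∨ (i = 1 ∧ j = 1) ∨ (i = 2 ∧ j = 2) ∨ (i = 0 ∧ j = 1) ∨
          (i = 1 ∧ j = 2) ∨ (i = 2 ∧ j = 0)) := by
      have h6 : (m 0 = 2 ∧ m 1 = 0 ∧ m 2 = 0) ∨ (m 0 = 0 ∧ m 1 = 2 ∧ m 2 = 0) ∨
          (m 0 = 0 ∧ m 1 = 0 ∧ m 2 = 2) ∨ (m 0 = 1 ∧ m 1 = 1 ∧ m 2 = 0) ∨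
          (m 0 = 0 ∧ m 1 = 1 ∧ m 2 = 1) ∨ (m 0 = 1 ∧ m 1 = 0 ∧ m 2 = 1) := by lia
      rcases h6 with ⟨h0, h1, h2⟩ | ⟨h0, h1, h2⟩ | ⟨h0, h1, h2⟩ | ⟨h0, h1, h2⟩ | ⟨h0, h1, h2⟩ |
        ⟨h0, h1, h2⟩
      · exact ⟨0, 0, by ext k; fin_cases k <;> simp [h0, h1, h2], by decide⟩
      · exact ⟨1, 1, by ext k; fin_cases k <;> simp [h0, h1, h2], by decide⟩
      · exact ⟨2, 2, by ext k; fin_cases k <;> simp [h0, h1, h2], by decide⟩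
      · exact ⟨0, 1, by ext k; fin_cases k <;> simp [h0, h1, h2], by decide⟩
      · exact ⟨1, 2, by ext k; fin_cases k <;> simp [h0, h1, h2], by decide⟩
      · exact ⟨2, 0, by ext k; fin_cases k <;> simp [h0, h1, h2], by decide⟩
    have hif : ∀ i j i' j' : Fin 3, ¬ ((i = i' ∧ j = j') ∨ (i = j' ∧ j = i')) →
        (if Finsupp.single i 1 + Finsupp.single j 1 =
          (Finsupp.single i' 1 + Finsupp.single j' 1 : Fin 3 →₀ ℕ) then (1 : ℂ) else 0) = 0 :=
      fun i j i' j' h => if_neg fun h' => h (hne h')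
    obtain ⟨i, j, rfl, hij⟩ := hex
    rcases hij with ⟨rfl, rfl⟩ | ⟨rfl, rfl⟩ | ⟨rfl, rfl⟩ | ⟨rfl, rfl⟩ | ⟨rfl, rfl⟩ | ⟨rfl, rfl⟩ <;>
    · simp only [if_true, mul_one]
      repeat rw [hif _ _ _ _ (by decide)]
      simp

/-- The scaled foliations `∑ e i • S i` are isomorphic to `S`. -/
theorem isomorphic_sField_of_scaled {e : Fin 3 → ℂ} (he : ∀ i, e i ≠ 0) :
    Isomorphic (fun i => C (e i) * sField i) sField := by
  -- With s i ^ 2 * e i = 1, all components acquire the same factor (s 0 * s 1 * s 2)⁻¹.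
  obtain ⟨s, hs⟩ := exists_units_pow_eq two_ne_zero (fun i => (e i)⁻¹)
    fun i => inv_ne_zero (he i)
  refine ⟨monomialGL 1 s, SameFoliation.symm ⟨((s 0 * s 1 * s 2)⁻¹ : ℂˣ), Units.ne_zero _, 0,
    fun i => ?_⟩⟩
  have h := push_monomialGL 1 s (fun i => C (e i) * sField i) i
  rw [Equiv.Perm.coe_one, id_eq] at h
  have h2 : ∀ i, (s i : ℂ) * e i = (s i : ℂ)⁻¹ := by
    intro i
    have : (s i : ℂ) ^ 2 * e i = 1 := by rw [hs, inv_mul_cancel₀ (he i)]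
    refine eq_inv_of_mul_eq_one_left ?_
    rw [← this]
    ring
  rw [h, map_mul, compInv_C, ← mul_assoc, ← map_mul, h2, zero_mul, add_zero]
  fin_cases i <;>
    simp [sField, compInv_monomialGL_X] <;> ring

/-- Invariance under the reflections X l ↦ -X l kills X k ^ 2 in the components other than k and
makes the coefficient of X j * X k in component j independent of j. The latter terms form a radial
multiple, and a rescaled S remains. -/
theorem isomorphic_sField {w : VField} (hw : ∀ i, (w i).IsHomogeneous 2)
    (hne : ∀ i : Fin 3, coeff (Finsupp.single (i + 1) 1 + Finsupp.single (i + 2) 1) (w i) ≠ 0)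
    (hfull : ∀ p : ℂˣ × ℂˣ, p.1 ^ 2 = 1 → p.2 ^ 2 = 1 → p ∈ diagonalAut w) :
    Isomorphic w sField := by
  have hmem : ∀ l : Fin 3, monomialGL 1 (Function.update 1 l (-1)) ∈ linearAut w := by
    intro l
    have h0 := mem_diagonalAut.1 (hfull (-1, 1) (by simp) (by simp))
    have h1 := mem_diagonalAut.1 (hfull (1, -1) (by simp) (by simp))
    have h2 := mem_diagonalAut.1 (hfull (-1, -1) (by simp) (by simp))
    fin_cases l
    · convert h0 using 2
      ext k; fin_cases k <;> simp
    · convert h1 using 2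
      ext k; fin_cases k <;> simp
    -- Up to the scalar -1, diag(-1, -1, 1) is the reflection in the last variable.
    · have := mul_mem h2 (scalar_mem_linearAut hw (-1))
      rw [monomialGL_mul_scalar] at this
      convert this using 2
      ext k; fin_cases k <;> simp
  have hrel : ∀ l : Fin 3, ∃ P : MvPolynomial (Fin 3) ℂ, ∀ j m,
      ((Function.update 1 l (-1) : Fin 3 → ℂˣ) j : ℂ) *
        ((monomialValue (Function.update 1 l (-1)) m)⁻¹ : ℂˣ) * coeff m (w j) =
        - coeff m (w j) + coeff m (P * X j) := by
    intro l
    obtain ⟨α, hα, P, hP⟩ := exists_coeff_relation (hmem l)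
    simp only [Equiv.Perm.coe_one, Finsupp.mapDomain_id, id_eq] at hP
    have h := hP l (Finsupp.single (l + 1) 1 + Finsupp.single (l + 2) 1)
    -- The term without X l in component l is free of radial corrections and changes sign under the
    -- reflection.
    have hα' : α = -1 := by
      apply mul_right_cancel₀ (hne l)
      rw [coeff_mul_X', if_neg, add_zero, monomialValue_add, monomialValue_single,
        monomialValue_single] at h
      · rw [← h]
        fin_cases l <;> simp
      · fin_cases l <;> simp
    subst hα'
    refine ⟨P, fun j m => ?_⟩
    rw [hP]
    ring
  have hsq : ∀ j k : Fin 3, k ≠ j →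
      coeff (Finsupp.single k 1 + Finsupp.single k 1) (w j) = 0 := by
    intro j k hjk
    obtain ⟨P, hP⟩ := hrel k
    have h := hP j (Finsupp.single k 1 + Finsupp.single k 1)
    rw [coeff_mul_X', if_neg, add_zero, monomialValue_add, monomialValue_single,
      Function.update_self, Function.update_of_ne hjk.symm] at h
    · simp at h
      linear_combination h / 2
    · simp [hjk]
  have hmix : ∀ j k : Fin 3, coeff (Finsupp.single j 1 + Finsupp.single k 1) (w j) =
      coeff (Finsupp.single 0 1 + Finsupp.single k 1) (w 0) := by
    intro j k
    -- A reflection fixing X k equates twice the coefficient, for every j, with the coefficient of X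
    -- k in P.
    obtain ⟨P, hP⟩ := hrel (k + 1)
    have hk : (Function.update 1 (k + 1) (-1) : Fin 3 → ℂˣ) k = 1 := by simp
    have key : ∀ j, 2 * coeff (Finsupp.single j 1 + Finsupp.single k 1) (w j) =
        coeff (Finsupp.single k 1) P := by
      intro j
      have h := hP j (Finsupp.single k 1 + Finsupp.single j 1)
      rw [coeff_mul_X, monomialValue_add, monomialValue_single, monomialValue_single,
        hk, add_comm (Finsupp.single k 1)] at h
      simp at h
      linear_combination h
    linear_combination (key j - key 0) / 2
  refine isomorphic_of_sameFoliation_left (v := fun i =>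
    C (coeff (Finsupp.single (i + 1) 1 + Finsupp.single (i + 2) 1) (w i)) * sField i)
    (SameFoliation.symm ⟨1, one_ne_zero,
      ∑ k, C (coeff (Finsupp.single 0 1 + Finsupp.single k 1) (w 0)) * X k, fun i => ?_⟩)
    (isomorphic_sField_of_scaled hne)
  have hc : ∀ j k : Fin 3, coeff (Finsupp.single k 1 + Finsupp.single j 1) (w j) =
      coeff (Finsupp.single 0 1 + Finsupp.single k 1) (w 0) := by
    intro j k
    rw [add_comm, hmix]
  rw [Fin.sum_univ_three]
  refine (quadratic_eq (hw i)).trans ?_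
  fin_cases i
  · simp [hsq 0 1, hsq 0 2, hc 0 2, sField]
    ring
  · simp [hsq 1 0, hsq 1 2, hmix 1 1, hc 1 0, hmix 1 2, sField]
    ring
  · simp [hsq 2 0, hsq 2 1, hmix 2 2, hc 2 1, hmix 2 0, sField]
    ring

/-- The term XY in the third component cannot be altered by a radial multiple, so it reveals the
degree. -/
theorem eq_two_of_isomorphic_sField {d : ℕ} {w : VField} (hw : ∀ i, (w i).IsHomogeneous d)
    (h : Isomorphic w sField) : d = 2 := by
  obtain ⟨φ, hφ⟩ := h
  obtain ⟨α, hα, P, hP⟩ := hφ.symm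
  have h1 := congrArg (coeff (Finsupp.single 0 1 + Finsupp.single 1 1)) (hP 2)
  rw [coeff_add, coeff_mul_X', if_neg (by simp), add_zero, coeff_C_mul] at h1
  have h2 : coeff (Finsupp.single 0 1 + Finsupp.single 1 1) (sField 2) = 1 := by
    change coeff _ (X 0 * X 1) = _
    rw [coeff_mul_X, coeff_X, if_pos rfl]
  rw [h2, mul_one] at h1
  have h3 := degree_eq_of_coeff_ne_zero (isHomogeneous_push φ hw 2) (h1 ▸ hα)
  simpa using h3.symm

/-- A constant field in general position has an automorphism that is not monomial. -/
theorem ne_zero_of_transverse {d : ℕ} {w : VField} (hw : ∀ i, (w i).IsHomogeneous d)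
    (hmon : projAut w ≤ monomialSubgroup) (hsym : FullySymmetric w) {m : Fin 3 →₀ ℕ}
    (hm : m 2 = 0) (hc : coeff m (w 2) ≠ 0) : d ≠ 0 := by
  rintro rfl
  have hm0 : m = 0 := by
    have := degree_eq_of_coeff_ne_zero (hw 2) hc
    ext k
    fin_cases k <;> simp <;> lia
  subst hm0
  have hne : ∀ i, coeff 0 (w i) ≠ 0 := by
    intro i
    obtain ⟨s, hs⟩ := hsym (Equiv.swap 2 i)
    have := coeff_mapDomain_ne_zero hs hm hc
    rwa [Finsupp.mapDomain_zero, Equiv.swap_apply_left] at this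
  have hwC : ∀ i, w i = C (coeff 0 (w i)) := fun i =>
    totalDegree_eq_zero_iff_eq_C.1 ((totalDegree_zero_iff_isHomogeneous _).2 (hw i))
  set a : Fin 3 → ℂ := fun i => coeff 0 (w i) with ha
  -- The transvection v ↦ v + (a 1 v 0 - a 0 v 1) a fixes a. Its first column has nonzero entries in
  -- rows 1 and 2, so it is not monomial.
  let M : Matrix (Fin 3) (Fin 3) ℂ := !![1 + a 0 * a 1, - (a 0 * a 0), 0;
    a 1 * a 1, 1 - a 1 * a 0, 0; a 2 * a 1, - (a 2 * a 0), 1]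
  have hdet : M.det = 1 := by
    simp only [M, Matrix.det_fin_three]
    simp
    ring
  let φ : GL (Fin 3) ℂ := GeneralLinearGroup.mkOfDetNeZero M (by rw [hdet]; exact one_ne_zero)
  have hφ : φ ∈ linearAut w := by
    rw [mem_linearAut]
    convert SameFoliation.refl w using 1
    funext i
    change ∑ j, C (M i j) * compInv φ (w j) = w i
    have hpush : ∀ j, compInv φ (w j) = C (a j) := fun j => by rw [hwC j, compInv_C]
    rw [hwC i]
    simp only [hpush, ← map_mul, ← map_sum]
    congr 1
    fin_cases i <;> simp [M, Fin.sum_univ_three] <;> ring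
  obtain ⟨σ, s, hs⟩ := hmon ⟨φ, hφ, rfl⟩
  obtain ⟨u, hu⟩ := ProjGenLinGroup.mk_eq_mk_iff.1 hs.symm
  rw [monomialGL_mul_scalar] at hu
  have h1 : (monomialGL σ fun j => s j * u).val 1 0 = M 1 0 := by rw [hu]; rfl
  have h2 : (monomialGL σ fun j => s j * u).val 2 0 = M 2 0 := by rw [hu]; rfl
  rw [monomialGL_apply] at h1 h2
  have n1 : M 1 0 ≠ 0 := mul_ne_zero (hne 1) (hne 1)
  have n2 : M 2 0 ≠ 0 := mul_ne_zero (hne 2) (hne 1)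
  split_ifs at h1 h2 with c1 c2
  · rw [← c2] at c1
    exact absurd c1 (by decide)
  · exact n2 h2.symm
  · exact n1 h1.symm
  · exact n1 h1.symm

theorem isomorphic_sField_of_le_card {d : ℕ} {w : VField}
    (hw : ∀ i, (w i).IsHomogeneous d) (hfin : Finite (projAut w))
    (hmon : projAut w ≤ monomialSubgroup) (hsym : FullySymmetric w)
    {m : Fin 3 →₀ ℕ} (hm : m 2 = 0) (hc : coeff m (w 2) ≠ 0)
    (hle : 3 * (d ^ 2 + d + 1) ≤ Nat.card (projAut w)) : Isomorphic w sField := by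
  have hd := ne_zero_of_transverse hw hmon hsym hm hc
  have hcard := card_projAut_le hw hfin hmon
  have hsum := degree_eq_of_coeff_ne_zero (hw 2) hc
  rw [hm, add_zero] at hsum
  set g := (m 0 + 1).gcd (m 1 + 1) with hgdef
  have hg : g ≠ 0 := by
    rw [hgdef, Ne, Nat.gcd_eq_zero_iff]
    lia
  have hdich := subgroup_prod_rootsOfUnity_dichotomy hg (diagonalAut w)
    fun p hp => pow_eq_one_of_transverse hsym hm hc hp
  have h0 : g ≤ m 0 + 1 := Nat.gcd_le_left _ (by lia)
  have h1 : g ≤ m 1 + 1 := Nat.gcd_le_right _ (by lia)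
  have hD : Nat.card (diagonalAut w) ≤ g ^ 2 := by
    rcases hdich with ⟨h, _⟩ | h <;> lia
  -- Here 2g ≤ d + 2, while the cardinality hypothesis gives d² + d + 1 ≤ 2g².
  have hd2 : d ≤ 2 := by nlinarith
  have hg2 : g ≤ 2 := by lia
  have hg' : g = 1 ∨ g = 2 := by lia
  rcases hg' with h | h
  · rw [h] at hD
    have : 1 ≤ d := by lia
    nlinarith
  · have hd' : d = 2 := by lia
    subst hd'
    rw [h] at hdich h0 h1
    rcases hdich with ⟨_, hfull⟩ | h'
    · refine isomorphic_sField hw (fun i => ?_) hfull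
      obtain ⟨s, hs⟩ := hsym (Equiv.addRight (i + 1))
      have := coeff_mapDomain_ne_zero hs hm hc
      have hm' : m = Finsupp.single 0 1 + Finsupp.single 1 1 := by
        ext k
        fin_cases k <;> simp <;> lia
      rw [hm', Finsupp.mapDomain_add, Finsupp.mapDomain_single, Finsupp.mapDomain_single] at this
      have e0 : Equiv.addRight (i + 1) (0 : Fin 3) = i + 1 := by simp
      have e1 : Equiv.addRight (i + 1) (1 : Fin 3) = i + 2 := by
        clear hs this e0
        revert i
        decide
      have e2 : Equiv.addRight (i + 1) (2 : Fin 3) = i := by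
        clear hs this e0 e1
        revert i
        decide
      rwa [e0, e1, e2] at this
    -- At most two diagonal automorphisms would give at most 12 < 21 automorphisms.
    · lia

theorem le_card_of_isomorphic_sField {w : VField} (hfin : Finite (projAut w))
    (h : Isomorphic w sField) : 24 ≤ Nat.card (projAut w) := by
  have hc := card_projAut_of_isomorphic h
  rw [← hc]
  refine le_card_projAut two_ne_zero ?_ monomialGL_mem_linearAut_sField
  refine Nat.finite_of_card_ne_zero ?_
  rw [hc]
  exact Nat.card_pos.ne'

end PlaneFoliation

end

/-! ### Conclusion in the coordinates given by ψ. -/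

theorem mainTheorem4 (d : ℕ) (F : PlaneFoliation.Foliation d) (hfin : Finite F.Aut)
    (ψ : GL (Fin 3) ℂ) (htype : PlaneFoliation.IsSecondTypeIn ψ F.Aut) :
    (PlaneFoliation.LineInvariant F.field (PlaneFoliation.infinityForm ψ) →
      (Nat.card F.Aut : ℤ) ≤ 6 * ((d : ℤ) - 1) ^ 2 ∧
      ((Nat.card F.Aut : ℤ) = 6 * ((d : ℤ) - 1) ^ 2 ↔
        PlaneFoliation.Isomorphic F.field (PlaneFoliation.fermatField d) ∨
        PlaneFoliation.Isomorphic F.field (PlaneFoliation.gField d)) ∧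
      (¬ PlaneFoliation.Isomorphic F.field (PlaneFoliation.fermatField d) →
        ¬ PlaneFoliation.Isomorphic F.field (PlaneFoliation.gField d) →
        Nat.card F.Aut < 3 * (d ^ 2 + d + 1))) ∧
    (PlaneFoliation.LineGenericallyTransverse F.field (PlaneFoliation.infinityForm ψ) →
      (3 * (d ^ 2 + d + 1) ≤ Nat.card F.Aut ↔
        PlaneFoliation.Isomorphic F.field PlaneFoliation.sField)) := by
  open PlaneFoliation in
  set w := push ψ F.field with hwdef
  have hw : ∀ i, (w i).IsHomogeneous d := isHomogeneous_push ψ F.homogeneous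
  have hcard : Nat.card F.Aut = Nat.card (projAut w) := (card_projAut_push ψ F.field).symm
  have hsecond : IsSecondType (projAut w) := by
    rw [hwdef, projAut_push]
    exact htype
  have hfinw : Finite (projAut w) := by
    refine Nat.finite_of_card_ne_zero ?_
    rw [← hcard]
    exact Nat.card_pos.ne'
  have hmon := hsecond.le_monomialSubgroup
  have hsym : FullySymmetric w := hsecond.exists_monomialGL_mem hw
  have hiso : ∀ u, Isomorphic F.field u ↔ Isomorphic w u :=
    fun u => (isomorphic_push_iff ψ F.field u).symm
  rw [hcard]
  simp only [hiso]
  refine ⟨fun hinv => ?_, fun htrans => ⟨fun hle => ?_, fun h => ?_⟩⟩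
  · have hax : AxesInvariant w := AxesInvariant.of_coeff hsym fun m hm =>
      coeff_eq_zero_of_eval_eq_zero (fun p hp => hinv.eval_push_eq_zero hp) hm
    obtain ⟨p, hp, hsing⟩ := exists_not_singular F.isolated ψ
    obtain ⟨m, hm, hm2⟩ := exists_mem_exponents hax hp hsing
    -- In degree 0 no component is divisible by its variable unless it vanishes, so no exponent
    -- could occur.
    obtain ⟨n, rfl⟩ : ∃ n, d = n + 1 := by
      rcases d with _ | n
      · exfalso
        obtain ⟨i, j, hij⟩ := hm
        have h0 : ∀ i, quotCoeff w i m = 0 := by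
          intro i
          by_contra hne
          have := degree_eq_of_coeff_ne_zero (hw i) hne
          simp only [Finsupp.add_apply] at this
          fin_cases i <;> simp at this
        exact hij (by rw [h0, h0])
      · exact ⟨n, rfl⟩
    have hn := ne_zero_of_axesInvariant hw hfinw hax
    obtain ⟨h1, h2⟩ := card_projAut_of_axesInvariant hw hfinw hmon hsym hax ⟨m, hm, hm2⟩
    have hpos : 0 < n ^ 2 := by positivity
    have hint : (6 * ((↑(n + 1) : ℤ) - 1) ^ 2) = ((6 * n ^ 2 : ℕ) : ℤ) := by
      push_cast
      ring
    rw [hint]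
    refine ⟨by exact_mod_cast h1, ⟨fun h => ?_, fun h => ?_⟩, fun hf hg => ?_⟩
    · rw [Nat.cast_inj] at h
      rcases h2 with h2 | h2 | h2
      · exact .inl h2
      · exact .inr h2
      · lia
    · rw [Nat.cast_inj]
      refine le_antisymm h1 ?_
      rcases h with h | h
      · rw [fermatField_eq] at h
        exact le_card_projAut_of_isomorphic_pureField hn _ fermatSymbol_perm hfinw h
      · exact le_card_projAut_of_isomorphic_pureField hn _ gSymbol_perm hfinw
          (Isomorphic.pureField_of_gField h)
    · have h3 : Nat.card (projAut w) ≤ 3 * n ^ 2 := by tauto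
      nlinarith
  · obtain ⟨p, hp, hne⟩ := htrans.exists_eval_push_ne_zero
    obtain ⟨m, hm, hc⟩ := exists_coeff_ne_zero_of_eval_ne_zero hp hne
    exact isomorphic_sField_of_le_card hw hfinw hmon hsym hm hc hle
  · have hd := eq_two_of_isomorphic_sField hw h
    have := le_card_of_isomorphic_sField hfinw h
    subst hd
    lia
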